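/- Let $F$ be a field of characteristic $3$, let $\alpha,\beta,\gamma,\delta\in F$ with $\alpha\neq 0$ and $\beta\neq 0$, put $f(a,b)=\alpha a^3+\beta a^2b+\gamma ab^2+\delta b^3$ and $\Phi(z,a,b)=z^3-f(a,b)$, and let $$C_\Phi=F\langle x,y : (ax+by)^3=f(a,b)\ \text{ for all } a,b\in F\rangle$$ be the Clifford algebra of $\Phi$. With $[u,v]=uv-vu$, define in $C_\Phi$ $$y_1=[x,y]+[x,[x,y]],\qquad y_2=y+y_1,\qquad w=\beta y_2+\gamma x+y_1^2 .$$ Let $\Delta=-\gamma^3\alpha+\gamma^2\beta^2-\beta^3\delta+\beta^6\in F$, and let $E_\Delta$ be the affine curve $s^2=r^3+\Delta$, with coordinate ring $F[r,s]=F[R,S]/(S^2-R^3-\Delta)$. For a commutative ring $K$ and $a,b\in K$ write $$[a,b)_{3,K}=K\langle u,v : u^3-u=a,\ v^3=b,\ vu-uv=v\rangle .$$ Then: 1. $C_\Phi$ is an Azumaya algebra of constant rank $9$ over its center. 2. The center of $C_\Phi$ is the subalgebra $F[w,y_1^3]$, and there is an isomorphism of $F$-algebras from $F[r,s]$ to the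 center sending $r\mapsto w$ and $s\mapsto y_1^3-\beta^3$. 3. Let $\bar F$ be an algebraic closure of $F$. There is a one-to-one correspondence between the orbits of $\mathrm{Aut}(\bar F/F)$ on the $\bar F$-rational points of $E_\Delta$ (singular points included) and the simple homomorphic images of $C_\Phi$ (that is, the quotients of $C_\Phi$ by two-sided ideals that are simple rings), such that for every point $(r_0,s_0)$ the image corresponding to its orbit is isomorphic, as an $F$-algebra, to the cyclic algebra $$[\alpha\beta^{-3}(s_0+\beta^3),\ \alpha)_{3,\,F[r_0,s_0]},$$ which is a central simple algebra of degree $3$ (dimension $9$) over the field $F[r_0,s_0]\subseteq\bar F$; the isomorphism can be chosen to send the images of $w$ and $y_1^3-\beta^3$ to $r_0$ and $s_0$. -/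

import Mathlib

/-- Defining relations of the Clifford algebra of the monic polynomial
`Φ(z, a, b) = z ^ 3 - f(a, b)`, where `f(a, b) = α a ^ 3 + β a ^ 2 b + γ a b ^ 2 + δ b ^ 3`:
`(a x + b y) ^ 3 = f(a, b)` for all `a, b ∈ F`. The generators `x, y` are indexed by `0, 1`. -/
inductive CliffordRel {F : Type*} [Field F] (α β γ δ : F) :
    FreeAlgebra F (Fin 2) → FreeAlgebra F (Fin 2) → Prop
  | rel (a b : F) : CliffordRel α β γ δ
      ((a • FreeAlgebra.ι F 0 + b • FreeAlgebra.ι F 1) ^ 3)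
      (algebraMap F (FreeAlgebra F (Fin 2))
        (α * a ^ 3 + β * a ^ 2 * b + γ * a * b ^ 2 + δ * b ^ 3))

/-- The Clifford algebra `C_Φ` of `Φ = z ^ 3 - (α a ^ 3 + β a ^ 2 b + γ a b ^ 2 + δ b ^ 3)`. -/
abbrev CPhi {F : Type*} [Field F] (α β γ δ : F) : Type _ :=
  RingQuot (CliffordRel α β γ δ)

namespace CPhi

variable {F : Type*} [Field F] (α β γ δ : F)

/-- The generator `x` of `C_Φ`. -/
noncomputable def x : CPhi α β γ δ :=
  RingQuot.mkAlgHom F (CliffordRel α β γ δ) (FreeAlgebra.ι F 0)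

/-- The generator `y` of `C_Φ`. -/
noncomputable def y : CPhi α β γ δ :=
  RingQuot.mkAlgHom F (CliffordRel α β γ δ) (FreeAlgebra.ι F 1)

/-- `y₁ = [x, y] + [x, [x, y]]`. In characteristic `3`, the elements `y₁` and `y₂ = y + y₁` are the
unique ones with `y = y₂ - y₁`, `x y₂ - y₂ x = y₁` and `x y₁ - y₁ x` commuting with `x`. -/
noncomputable def y₁ : CPhi α β γ δ :=
  ⁅x α β γ δ, y α β γ δ⁆ + ⁅x α β γ δ, ⁅x α β γ δ, y α β γ δ⁆⁆

/-- `y₂ = y + y₁`. -/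
noncomputable def y₂ : CPhi α β γ δ :=
  y α β γ δ + y₁ α β γ δ

/-- `w = β y₂ + γ x + y₁ ^ 2`. -/
noncomputable def w : CPhi α β γ δ :=
  β • y₂ α β γ δ + γ • x α β γ δ + y₁ α β γ δ ^ 2

/-- `Δ = -γ ^ 3 α + γ ^ 2 β ^ 2 - β ^ 3 δ + β ^ 6`. -/
def Δ : F := -γ ^ 3 * α + γ ^ 2 * β ^ 2 - β ^ 3 * δ + β ^ 6

end CPhi

/-- The (possibly singular) affine plane cubic `E_D : s ^ 2 = r ^ 3 + D`. -/
def cubicCurve {F : Type*} [Field F] (D : F) : WeierstrassCurve.Affine F :=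
  ⟨0, 0, 0, 0, D⟩

/-- The points of `E_D : s ^ 2 = r ^ 3 + D` with coordinates in the algebraic closure of `F`. -/
@[ext]
structure CubicPoint {F : Type*} [Field F] (D : F) where
  r : AlgebraicClosure F
  s : AlgebraicClosure F
  eq : s ^ 2 = r ^ 3 + algebraMap F (AlgebraicClosure F) D

namespace CubicPoint

variable {F : Type*} [Field F] {D : F}

/-- The automorphisms of the algebraic closure over `F` act coordinatewise on the points. -/
noncomputable instance :
    MulAction (AlgebraicClosure F ≃ₐ[F] AlgebraicClosure F) (CubicPoint D) where
  smul σ P := ⟨σ P.r, σ P.s, by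
    rw [← map_pow, P.eq, map_add, map_pow, AlgEquiv.commutes]⟩
  one_smul _ := rfl
  mul_smul _ _ _ := rfl

/-- The field `F[r₀, s₀]` generated by the coordinates of the point `(r₀, s₀)`. -/
noncomputable abbrev field (P : CubicPoint D) : IntermediateField F (AlgebraicClosure F) :=
  IntermediateField.adjoin F {P.r, P.s}

/-- `r₀` as an element of `F[r₀, s₀]`. -/
noncomputable def r₀ (P : CubicPoint D) : P.field :=
  ⟨P.r, IntermediateField.subset_adjoin F _ (by simp)⟩

/-- `s₀` as an element of `F[r₀, s₀]`. -/
noncomputable def s₀ (P : CubicPoint D) : P.field :=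
  ⟨P.s, IntermediateField.subset_adjoin F _ (by simp)⟩

end CubicPoint

/-- The Galois orbits of points of `E_D` over the algebraic closure of `F`. -/
abbrev CubicOrbit {F : Type*} [Field F] (D : F) : Type _ :=
  MulAction.orbitRel.Quotient (AlgebraicClosure F ≃ₐ[F] AlgebraicClosure F) (CubicPoint D)

/-- Defining relations of `[a, b)_{p, R}`, with generators `x, y` indexed by `0, 1`:
`x ^ p - x = a`, `y ^ p = b` and `y x - x y = y`. -/
inductive SymbolRel (p : ℕ) (R : Type*) [CommRing R] (a b : R) :
    FreeAlgebra R (Fin 2) → FreeAlgebra R (Fin 2) → Prop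
  | artinSchreier : SymbolRel p R a b
      (FreeAlgebra.ι R 0 ^ p - FreeAlgebra.ι R 0) (algebraMap R (FreeAlgebra R (Fin 2)) a)
  | central : SymbolRel p R a b
      (FreeAlgebra.ι R 1 ^ p) (algebraMap R (FreeAlgebra R (Fin 2)) b)
  | commutator : SymbolRel p R a b
      (FreeAlgebra.ι R 1 * FreeAlgebra.ι R 0 - FreeAlgebra.ι R 0 * FreeAlgebra.ι R 1)
      (FreeAlgebra.ι R 1)

/-- The symbol algebra
`[a, b)_{p, R} = R⟨x, y : x ^ p - x = a, y ^ p = b, y x - x y = y⟩`. Over a field `R` of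
characteristic `p` and for `b ≠ 0`, these are the cyclic algebras of degree `p` over `R`. -/
abbrev SymbolAlg (p : ℕ) (R : Type*) [CommRing R] (a b : R) : Type _ :=
  RingQuot (SymbolRel p R a b)

/-- The simple homomorphic images of a ring `A`, each recorded by its kernel: the two-sided ideals
of `A` whose quotient is a simple ring. -/
abbrev SimpleImage (A : Type*) [Ring A] : Type _ :=
  {I : TwoSidedIdeal A // IsSimpleRing I.ringCon.Quotient}

/-- The cyclic algebra `[α β⁻³ (s₀ + β ^ 3), α)_{3, F[r₀, s₀]}` attached to the point
`(r₀, s₀)`. -/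
abbrev pointAlg {F : Type*} [Field F] {D : F} (α β : F) (P : CubicPoint D) : Type _ :=
  SymbolAlg 3 P.field
    (algebraMap F P.field (α * (β ^ 3)⁻¹) * (P.s₀ + algebraMap F P.field (β ^ 3)))
    (algebraMap F P.field α)

/-! Write `z = y₁`. In characteristic 3, polarizing the cubic relations gives `(ad x)² y = β` and
`(ad y)² x = γ`. Hence `z = [x, y] + β` satisfies `[x, z] = β` and `[y, z] = -γ`, and `w = β (y + z)
+ γ x + z ^ 2` is central. Solving for `β y` and cubing turns `y ^ 3 = δ` into the curve equation
`(z ^ 3 - β ^ 3) ^ 2 = w ^ 3 + Δ`. So `C_Φ` is presented by `x, z, w` subject to `WeylRel`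
(`weylRel_of_cube`, `WeylRel.exists_lift`).

The substitution `u = β⁻¹ z x`, `v = x`, with inverse `z = β α⁻¹ u v ^ 2`, turns these relations
into those of the symbol algebra `[α β⁻³ (s + β ^ 3), α)` over `F[r, s]`, where `r = w` and `s = z ^
3 - β ^ 3`.

The structure theory rests on one property, `SandwichDual`: the coordinates with respect to the `u ^
i * v ^ j` are sums of operators `t ↦ a * t * b`. This makes central elements scalars and generates
every two-sided ideal by scalars; when the scalars embed, it also makes the algebra free and
Azumaya. A matrix representation shows that `F[r, s]` embeds (`SymbolAlg.algebraMap_injective`).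

Two-sided ideals of `C_Φ` are therefore governed by their traces on `F[r, s]`. Simple images
correspond to maximal ideals of `F[r, s]`, which by the Nullstellensatz are Galois orbits of points;
specializing at a point gives the symbol algebra over its residue field. -/

/-! ### Algebras with a spanning family dual to sandwich operators -/

/-- A family `e` spans the `R`-algebra `A` and its coordinate functions, with values in `R · 1`, are
sums of operators `x ↦ a * x * b`. -/
structure SandwichDual (R : Type*) {A ι : Type*} [CommRing R] [Ring A] [Algebra R A]
    [DecidableEq ι] (e : ι → A) : Prop where
  span_eq_top : Submodule.span R (Set.range e) = ⊤
  exists_dual : ∀ i, ∃ E ∈ (AlgHom.mulLeftRight R A).range, ∀ j, E (e j) = if i = j then 1 else 0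

section Sandwich

variable {R A ι : Type*} [CommRing R] [Ring A] [Algebra R A]

lemma mulLeft_mem_range_mulLeftRight (a : A) :
    LinearMap.mulLeft R a ∈ (AlgHom.mulLeftRight R A).range :=
  ⟨a ⊗ₜ 1, by ext; simp⟩

lemma mulRight_mem_range_mulLeftRight (a : A) :
    LinearMap.mulRight R a ∈ (AlgHom.mulLeftRight R A).range :=
  ⟨1 ⊗ₜ MulOpposite.op a, by ext; simp⟩

lemma TwoSidedIdeal.apply_mem_of_mem_range_mulLeftRight (I : TwoSidedIdeal A)
    {φ : Module.End R A} (hφ : φ ∈ (AlgHom.mulLeftRight R A).range) {x : A} (hx : x ∈ I) :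
    φ x ∈ I := by
  obtain ⟨t, rfl⟩ := hφ
  induction t using TensorProduct.induction_on with
  | zero => simp
  | tmul a b => simpa using I.mul_mem_right _ _ (I.mul_mem_left _ _ hx)
  | add s t hs ht => simpa using I.add_mem hs ht

lemma apply_eq_mul_of_mem_range_mulLeftRight
    {φ : Module.End R A} (hφ : φ ∈ (AlgHom.mulLeftRight R A).range) {z : A}
    (hz : ∀ x, x * z = z * x) : φ z = z * φ 1 := by
  obtain ⟨t, rfl⟩ := hφ
  induction t using TensorProduct.induction_on with
  | zero => simp
  | tmul a b => simp [hz a, mul_assoc]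
  | add s t hs ht => simp_all [mul_add]

namespace SandwichDual

variable [DecidableEq ι] [Fintype ι] {e : ι → A}

lemma linearIndependent (h : SandwichDual R e) (hinj : Function.Injective (algebraMap R A)) :
    LinearIndependent R e := by
  rw [Fintype.linearIndependent_iff]
  intro g hg i
  obtain ⟨E, -, hE⟩ := h.exists_dual i
  apply hinj
  have := congrArg E hg
  simpa [hE, Algebra.algebraMap_eq_smul_one] using this

/-- The basis underlying a spanning family with a dual family of sandwich operators. -/
noncomputable def basis (h : SandwichDual R e) (hinj : Function.Injective (algebraMap R A)) :
    Module.Basis ι R A :=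
  Module.Basis.mk (h.linearIndependent hinj) h.span_eq_top.ge

lemma exists_repr (h : SandwichDual R e) (a : A) :
    ∃ c : ι → R, a = ∑ i, c i • e i ∧
      ∀ i, ∃ E ∈ (AlgHom.mulLeftRight R A).range, E a = algebraMap R A (c i) ∧
        ∀ j, E (e j) = if i = j then 1 else 0 := by
  have ha : a ∈ Submodule.span R (Set.range e) := h.span_eq_top ▸ Submodule.mem_top
  obtain ⟨c, rfl⟩ := (Submodule.mem_span_range_iff_exists_fun R).1 ha
  refine ⟨c, rfl, fun i ↦ ?_⟩
  obtain ⟨E, hE, hE'⟩ := h.exists_dual i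
  exact ⟨E, hE, by simp [hE', Algebra.algebraMap_eq_smul_one], hE'⟩

/-- A two-sided ideal is generated by the scalars it contains. -/
lemma twoSidedIdeal_le (h : SandwichDual R e) {I J : TwoSidedIdeal A}
    (hIJ : ∀ r : R, algebraMap R A r ∈ I → algebraMap R A r ∈ J) : I ≤ J := by
  intro a ha
  obtain ⟨c, rfl, hc⟩ := h.exists_repr a
  refine sum_mem fun i _ ↦ ?_
  obtain ⟨E, hE, hE', -⟩ := hc i
  rw [Algebra.smul_def]
  exact J.mul_mem_right _ _ (hIJ _ (hE' ▸ I.apply_mem_of_mem_range_mulLeftRight hE ha))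

/-- Sandwich operators are linear over the center, so the coordinate operator at `e i₀ = 1` fixes
`z`, while its values are scalars. -/
lemma mem_range_algebraMap_of_central (h : SandwichDual R e) {i₀ : ι} (h₀ : e i₀ = 1) {z : A}
    (hz : ∀ x, x * z = z * x) : z ∈ (algebraMap R A).range := by
  obtain ⟨c, -, hc⟩ := h.exists_repr z
  obtain ⟨E, hE, hE', hE''⟩ := hc i₀
  refine ⟨c i₀, ?_⟩
  rw [← hE', apply_eq_mul_of_mem_range_mulLeftRight hE hz, ← h₀, hE'', if_pos rfl, mul_one]

/-- An endomorphism `φ` equals `∑ i, φ (e i) * E i`, a sandwich operator, which gives surjectivity.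
Injectivity follows because both sides are free of the same finite rank. -/
lemma isAzumaya (h : SandwichDual R e) (hinj : Function.Injective (algebraMap R A)) :
    IsAzumaya R A := by
  let b := h.basis hinj
  have : Module.Free R A := .of_basis b
  have : Module.Finite R A := .of_basis b
  have : FaithfulSMul R A := (faithfulSMul_iff_algebraMap_injective R A).2 hinj
  have hsurj : Function.Surjective (AlgHom.mulLeftRight R A) := by
    intro φ
    choose E hE hE' using h.exists_dual
    have : φ = ∑ i, LinearMap.mulLeft R (φ (e i)) * E i := by
      refine b.ext fun j ↦ ?_
      simp [b, basis, hE']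
    rw [← AlgHom.mem_range, this]
    exact sum_mem fun i _ ↦ mul_mem (mulLeft_mem_range_mulLeftRight _) (hE i)
  let bop : Module.Basis ι R Aᵐᵒᵖ := b.map (MulOpposite.opLinearEquiv R)
  let eqv : Module.End R A ≃ₗ[R] TensorProduct R A Aᵐᵒᵖ :=
    (LinearMap.toMatrix b b).trans ((Matrix.stdBasis R ι ι).equiv (b.tensorProduct bop) (.refl _))
  have hinj' : Function.Injective
      (eqv.toLinearMap ∘ₗ (AlgHom.mulLeftRight R A).toLinearMap) :=
    OrzechProperty.injective_of_surjective_endomorphism _ (eqv.surjective.comp hsurj)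
  exact { bij := ⟨Function.Injective.of_comp (f := eqv) hinj', hsurj⟩ }

lemma finrank_eq [Nontrivial R] (h : SandwichDual R e)
    (hinj : Function.Injective (algebraMap R A)) : Module.finrank R A = Fintype.card ι :=
  Module.finrank_eq_card_basis (h.basis hinj)

lemma rankAtStalk_eq (h : SandwichDual R e) (hinj : Function.Injective (algebraMap R A))
    (p : PrimeSpectrum R) : Module.rankAtStalk A p = Fintype.card ι := by
  have : Nontrivial R := p.nontrivial
  have : Module.Free R A := .of_basis (h.basis hinj)
  have : Module.Finite R A := .of_basis (h.basis hinj)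
  rw [Module.rankAtStalk_eq_finrank_of_free]
  simp [h.finrank_eq hinj]

end SandwichDual

lemma SandwichDual.isSimpleRing {K : Type*} [Field K] [Algebra K A] [Nontrivial A]
    [DecidableEq ι] [Fintype ι] {e : ι → A} (h : SandwichDual K e) : IsSimpleRing A := by
  refine .of_eq_bot_or_eq_top fun I ↦ ?_
  by_cases hI : ∃ r : K, r ≠ 0 ∧ algebraMap K A r ∈ I
  · right
    obtain ⟨r, hr, hrI⟩ := hI
    refine I.eq_top ?_
    have := I.mul_mem_left (algebraMap K A r⁻¹) _ hrI
    rwa [← map_mul, inv_mul_cancel₀ hr, map_one] at this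
  · left
    push Not at hI
    refine le_bot_iff.1 (h.twoSidedIdeal_le fun r hr ↦ ?_)
    by_cases h0 : r = 0
    · simp [h0]
    · exact absurd hr (hI r h0)

end Sandwich

/-! ### Dual sandwich operators for the symbol relations in degree 3 -/

section SymbolBasis

variable {R A : Type*} [CommRing R] [Ring A] [Algebra R A]

/-- The spanning family `u ^ i * v ^ j`, `i, j < 3`, of a symbol algebra of degree `3`. -/
def symbolFamily (u v : A) (ij : Fin 3 × Fin 3) : A :=
  u ^ (ij.1 : ℕ) * v ^ (ij.2 : ℕ)

lemma mul_eq_add_of_commutator {u v : A} (huv : v * u - u * v = v) : v * u = (u + 1) * v := by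
  rw [add_mul, one_mul, add_comm]
  exact sub_eq_iff_eq_add.1 huv

lemma span_symbolFamily {a b : R} {u v : A} (hu : u ^ 3 - u = algebraMap R A a)
    (hv : v ^ 3 = algebraMap R A b) (huv : v * u - u * v = v)
    (hgen : Algebra.adjoin R {u, v} = ⊤) :
    Submodule.span R (Set.range (symbolFamily u v)) = ⊤ := by
  set M := Submodule.span R (Set.range (symbolFamily u v)) with hM
  have hlt : ∀ i j : ℕ, i < 3 → j < 3 → u ^ i * v ^ j ∈ M := fun i j hi hj ↦
    Submodule.subset_span ⟨(⟨i, hi⟩, ⟨j, hj⟩), rfl⟩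
  have hu3 : u ^ 3 = u + algebraMap R A a := by rw [← hu]; abel
  -- Left multiplication by `v` can raise its exponent to 3, hence the bound 4.
  have hj3 : ∀ i j : ℕ, i < 3 → j < 4 → u ^ i * v ^ j ∈ M := by
    intro i j hi hj
    rcases Nat.lt_succ_iff_lt_or_eq.1 hj with hj | rfl
    · exact hlt i j hi hj
    · rw [hv, ← Algebra.commutes, ← Algebra.smul_def]
      simpa using M.smul_mem b (hlt i 0 hi (by norm_num))
  have hvu := mul_eq_add_of_commutator huv
  have hmulu : ∀ m ∈ M, u * m ∈ M := by
    intro m hm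
    induction hm using Submodule.span_induction with
    | zero => simp
    | add x y _ _ hx hy => simpa [mul_add] using M.add_mem hx hy
    | smul r x _ hx => simpa using M.smul_mem r hx
    | mem x hx =>
      obtain ⟨⟨i, j⟩, rfl⟩ := hx
      simp only [symbolFamily, ← mul_assoc, ← pow_succ']
      by_cases hi : (i : ℕ) + 1 < 3
      · exact hlt _ _ hi j.2
      · have : (i : ℕ) + 1 = 3 := by omega
        rw [this, hu3, add_mul, ← Algebra.smul_def]
        refine M.add_mem ?_ (M.smul_mem _ ?_)
        · simpa using hlt 1 j (by norm_num) j.2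
        · simpa using hlt 0 j (by norm_num) j.2
  have hmulv : ∀ m ∈ M, v * m ∈ M := by
    intro m hm
    induction hm using Submodule.span_induction with
    | zero => simp
    | add x y _ _ hx hy => simpa [mul_add] using M.add_mem hx hy
    | smul r x _ hx => simpa using M.smul_mem r hx
    | mem x hx =>
      obtain ⟨⟨i, j⟩, rfl⟩ := hx
      have hpow : ∀ i : ℕ, v * u ^ i = (u + 1) ^ i * v := fun i ↦
        (SemiconjBy.pow_right (show SemiconjBy v u (u + 1) from hvu) i).eq
      simp only [symbolFamily, ← mul_assoc, hpow]
      rw [mul_assoc, ← pow_succ']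
      have h0 := hj3 0 (j + 1) (by norm_num) (by omega)
      have h1 := hmulu _ h0
      have h2 := hmulu _ h1
      simp only [pow_zero, one_mul] at h0 h1 h2
      fin_cases i
      · simpa using h0
      · simpa [add_mul] using M.add_mem h1 h0
      · have : (u + 1) ^ 2 * v ^ ((j : ℕ) + 1) = u * (u * v ^ ((j : ℕ) + 1)) +
            (u * v ^ ((j : ℕ) + 1) + u * v ^ ((j : ℕ) + 1)) + v ^ ((j : ℕ) + 1) := by
          noncomm_ring
        simpa [this] using M.add_mem (M.add_mem h2 (M.add_mem h1 h1)) h0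
  rw [eq_top_iff]
  rintro x -
  have hx : ∀ m ∈ M, x * m ∈ M := by
    have hx : x ∈ Algebra.adjoin R {u, v} := hgen ▸ Algebra.mem_top
    induction hx using Algebra.adjoin_induction with
    | mem x hx =>
      rcases hx with rfl | rfl
      exacts [hmulu, hmulv]
    | algebraMap r => exact fun m hm ↦ by simpa [← Algebra.smul_def] using M.smul_mem r hm
    | add x y _ _ hx hy => exact fun m hm ↦ by simpa [add_mul] using M.add_mem (hx m hm) (hy m hm)
    | mul x y _ _ hx hy => exact fun m hm ↦ by simpa [mul_assoc] using hx _ (hy m hm)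
  simpa using hx 1 (by simpa using hlt 0 0 (by norm_num) (by norm_num))

/-- The operator `D = [·, u]` multiplies `u ^ k * v ^ l` by `l` modulo 3. A quadratic polynomial in
`D` projects onto the eigenvalue `j`, and right multiplication by `v⁻ʲ` then removes `v ^ j`. -/
lemma exists_dual_v (h3 : (3 : A) = 0) {b : R} (hb : IsUnit b) {u v : A}
    (hv : v ^ 3 = algebraMap R A b) (huv : v * u - u * v = v) (j : Fin 3) :
    ∃ E ∈ (AlgHom.mulLeftRight R A).range,
      ∀ k l : Fin 3, E (symbolFamily u v (k, l)) = if j = l then u ^ (k : ℕ) else 0 := by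
  obtain ⟨b, rfl⟩ := hb
  set S := (AlgHom.mulLeftRight R A).range
  set v' : A := algebraMap R A (↑b⁻¹) * v ^ 2 with hv'
  have hvv' : v * v' = 1 := by
    rw [hv', ← mul_assoc, ← Algebra.commutes, mul_assoc, ← pow_succ', hv, ← map_mul]
    simp
  let D : Module.End R A := LinearMap.mulRight R u - LinearMap.mulLeft R u
  have hD : D ∈ S :=
    sub_mem (mulRight_mem_range_mulLeftRight u) (mulLeft_mem_range_mulLeftRight u)
  have hvu : v * u = u * v + v := by rw [mul_eq_add_of_commutator huv]; noncomm_ring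
  have hDv : ∀ k l : ℕ, D (u ^ k * v ^ l) = (l : A) * (u ^ k * v ^ l) := by
    intro k l
    have hl : v ^ l * u = u * v ^ l + (l : A) * v ^ l := by
      induction l with
      | zero => simp
      | succ l ih =>
        rw [pow_succ', mul_assoc, ih, mul_add, ← mul_assoc, hvu, ← mul_assoc v (l : A),
          ← Nat.cast_comm l v]
        push_cast
        noncomm_ring
    have hc : u * u ^ k = u ^ k * u := by rw [← pow_succ, ← pow_succ']
    simp only [D, LinearMap.sub_apply, LinearMap.mulRight_apply, LinearMap.mulLeft_apply]
    rw [mul_assoc, hl, mul_add, ← mul_assoc u, hc, ← mul_assoc (u ^ k) (l : A),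
      ← Nat.cast_comm l (u ^ k)]
    noncomm_ring
  have h2 : (2 : A) = -1 := by
    rw [eq_neg_iff_add_eq_zero, ← h3]; norm_num
  have hr : LinearMap.mulRight R (v' ^ (j : ℕ)) ∈ S := mulRight_mem_range_mulLeftRight _
  have hD0 : ∀ k : ℕ, D (u ^ k) = 0 := fun k ↦ by simpa using hDv k 0
  have hD1 : ∀ k : ℕ, D (u ^ k * v) = u ^ k * v := fun k ↦ by simpa using hDv k 1
  have hD2 : ∀ k : ℕ, D (u ^ k * v ^ 2) = - (u ^ k * v ^ 2) := fun k ↦ by simpa [h2] using hDv k 2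
  have hvv'2 : v ^ 2 * v' ^ 2 = 1 := by
    rw [pow_two, pow_two, mul_assoc, ← mul_assoc v v', hvv', one_mul, hvv']
  have h4 : ∀ x : A, -x + -x = x := fun x ↦ by
    rw [← sub_eq_zero, show -x + -x - x = -(3 * x) by noncomm_ring, h3]
    simp
  fin_cases j
  · refine ⟨1 - D * D, sub_mem (one_mem _) (mul_mem hD hD), fun k l ↦ ?_⟩
    fin_cases l <;> simp [symbolFamily, hD0, hD1, hD2]
  · refine ⟨_, mul_mem hr (neg_mem (add_mem (mul_mem hD hD) hD)), fun k l ↦ ?_⟩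
    fin_cases l <;> simp [symbolFamily, hD0, hD1, hD2, h4]
    rw [mul_assoc, hvv', mul_one]
  · refine ⟨_, mul_mem hr (neg_mem (sub_mem (mul_mem hD hD) hD)), fun k l ↦ ?_⟩
    fin_cases l <;> simp [symbolFamily, hD0, hD1, hD2, h4, sub_eq_add_neg]
    rw [mul_assoc, hvv'2, mul_one]

/-- Conjugation by `v` shifts `u` to `u + 1`, so `T` is the forward difference on polynomials in
`u`. The coefficients of a polynomial of degree at most 2 are read off from the top: `T ^ 2` sends
`u ^ 2` to `-1`. -/
lemma exists_dual_u (h3 : (3 : A) = 0) {b : R} (hb : IsUnit b) {u v : A}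
    (hv : v ^ 3 = algebraMap R A b) (huv : v * u - u * v = v) (i : Fin 3) :
    ∃ E ∈ (AlgHom.mulLeftRight R A).range,
      ∀ k : Fin 3, E (u ^ (k : ℕ)) = if i = k then 1 else 0 := by
  obtain ⟨b, rfl⟩ := hb
  set S := (AlgHom.mulLeftRight R A).range
  set v' : A := algebraMap R A (↑b⁻¹) * v ^ 2 with hv'
  have hvv' : v * v' = 1 := by
    rw [hv', ← mul_assoc, ← Algebra.commutes, mul_assoc, ← pow_succ', hv, ← map_mul]
    simp
  let T : Module.End R A := LinearMap.mulLeft R v * LinearMap.mulRight R v' - 1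
  have hT : T ∈ S := sub_mem (mul_mem (mulLeft_mem_range_mulLeftRight v)
    (mulRight_mem_range_mulLeftRight v')) (one_mem _)
  have hTu : ∀ k : ℕ, T (u ^ k) = (u + 1) ^ k - u ^ k := fun k ↦ by
    have := (SemiconjBy.pow_right (show SemiconjBy v u (u + 1) from
      mul_eq_add_of_commutator huv) k).eq
    simp [T, ← mul_assoc, this]
    simp [mul_assoc, hvv']
  have h2 : (2 : A) = -1 := by
    rw [eq_neg_iff_add_eq_zero, ← h3]; norm_num
  have hT0 : T 1 = 0 := by simpa using hTu 0
  have hT1 : T u = 1 := by simpa using hTu 1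
  have hT2 : T (u ^ 2) = 1 - u := by
    rw [hTu, show (u + 1) ^ 2 - u ^ 2 = 2 * u + 1 by noncomm_ring, h2]; noncomm_ring
  let E2 : Module.End R A := - (T * T)
  let E1 : Module.End R A := T - LinearMap.mulLeft R (1 - u) * E2
  let E0 : Module.End R A :=
    1 - LinearMap.mulLeft R u * E1 - LinearMap.mulLeft R (u ^ 2) * E2
  have hE2 : E2 ∈ S := neg_mem (mul_mem hT hT)
  have hE1 : E1 ∈ S := sub_mem hT (mul_mem (mulLeft_mem_range_mulLeftRight _) hE2)
  have hE0 : E0 ∈ S := sub_mem (sub_mem (one_mem _) (mul_mem (mulLeft_mem_range_mulLeftRight _)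
    hE1)) (mul_mem (mulLeft_mem_range_mulLeftRight _) hE2)
  fin_cases i
  · exact ⟨E0, hE0, fun k ↦ by fin_cases k <;> simp [E0, E1, E2, hT0, hT1, hT2]⟩
  · exact ⟨E1, hE1, fun k ↦ by fin_cases k <;> simp [E1, E2, hT0, hT1, hT2]⟩
  · exact ⟨E2, hE2, fun k ↦ by fin_cases k <;> simp [E2, hT0, hT1, hT2]⟩

/-- An algebra generated by `u, v` with `u ^ 3 - u = a`, `v ^ 3 = b` a unit and `v u - u v = v` is
spanned by the `u ^ i * v ^ j`, and their coordinate functions are sums of sandwich operators. -/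
lemma sandwichDual_symbolFamily (h3 : (3 : A) = 0) {a b : R} (hb : IsUnit b) {u v : A}
    (hu : u ^ 3 - u = algebraMap R A a) (hv : v ^ 3 = algebraMap R A b) (huv : v * u - u * v = v)
    (hgen : Algebra.adjoin R {u, v} = ⊤) : SandwichDual R (symbolFamily u v) where
  span_eq_top := span_symbolFamily hu hv huv hgen
  exists_dual := by
    rintro ⟨i, j⟩
    obtain ⟨E, hE, hE'⟩ := exists_dual_u h3 hb hv huv i
    obtain ⟨G, hG, hG'⟩ := exists_dual_v h3 hb hv huv j
    refine ⟨E * G, mul_mem hE hG, ?_⟩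
    rintro ⟨k, l⟩
    rw [Module.End.mul_apply, hG']
    split_ifs with h1 h2 h2 <;> simp_all

end SymbolBasis

/-! ### Symbol algebras: presentation, faithfulness and central simplicity -/

namespace SymbolAlg

section

variable (p : ℕ) (R : Type*) [CommRing R] (a b : R)

/-- The generator `u` of `[a, b)_{p, R}`, with `u ^ p - u = a`. -/
noncomputable def u : SymbolAlg p R a b := RingQuot.mkAlgHom R _ (FreeAlgebra.ι R 0)

/-- The generator `v` of `[a, b)_{p, R}`, with `v ^ p = b`. -/
noncomputable def v : SymbolAlg p R a b := RingQuot.mkAlgHom R _ (FreeAlgebra.ι R 1)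

lemma u_pow_sub_u : u p R a b ^ p - u p R a b = algebraMap R _ a := by
  simpa [u] using RingQuot.mkAlgHom_rel R (SymbolRel.artinSchreier (p := p) (a := a) (b := b))

lemma v_pow : v p R a b ^ p = algebraMap R _ b := by
  simpa [v] using RingQuot.mkAlgHom_rel R (SymbolRel.central (p := p) (a := a) (b := b))

lemma v_mul_u_sub : v p R a b * u p R a b - u p R a b * v p R a b = v p R a b := by
  simpa [u, v] using RingQuot.mkAlgHom_rel R (SymbolRel.commutator (p := p) (a := a) (b := b))

lemma adjoin_eq_top : Algebra.adjoin R {u p R a b, v p R a b} = ⊤ := by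
  have hs : Function.Surjective (RingQuot.mkAlgHom R (SymbolRel p R a b)) :=
    RingQuot.mkAlgHom_surjective _ _
  rw [← (AlgHom.range_eq_top _).2 hs, ← Algebra.map_top, ← FreeAlgebra.adjoin_range_ι,
    AlgHom.map_adjoin, ← Set.range_comp]
  congr 1
  ext x
  simp [u, v, Fin.exists_fin_two, eq_comm]

variable {p R a b} {B : Type*} [Ring B] [Algebra R B]

/-- The universal property of `[a, b)_{p, R}`. -/
noncomputable def lift (U V : B) (hU : U ^ p - U = algebraMap R B a)
    (hV : V ^ p = algebraMap R B b) (hVU : V * U - U * V = V) : SymbolAlg p R a b →ₐ[R] B :=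
  RingQuot.liftAlgHom R ⟨FreeAlgebra.lift R ![U, V], by
    rintro _ _ ⟨⟩ <;> simpa⟩

end

section Degree3

variable {R : Type*} [CommRing R] (h3 : (3 : R) = 0) (a : R) {b : R}

include h3

/-- The algebra acts by 3 × 3 matrices over `R[θ]/(θ ^ 3 - θ - a)`, which is free and nonzero over
`R`: `u` is diagonal with entries `θ, θ + 1, θ + 2`, and `v` is a cyclic shift weighted by `b`. -/
lemma algebraMap_injective : Function.Injective (algebraMap R (SymbolAlg 3 R a b)) := by
  open Polynomial in
  nontriviality R
  let f : R[X] := X ^ 3 - (X + C a)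
  have hf : f.Monic := monic_X_pow_sub (by rw [degree_X_add_C]; norm_num)
  have hdeg : f.degree = 3 := by
    dsimp only [f]; compute_degree!
  have : Nontrivial (AdjoinRoot f) := Ideal.Quotient.nontrivial_iff.mpr <| by
    rw [Ne, Ideal.span_singleton_eq_top, hf.isUnit_iff]
    intro h
    simp [h] at hdeg
  have : Module.Free R (AdjoinRoot f) := hf.free_adjoinRoot
  let θ : AdjoinRoot f := AdjoinRoot.root f
  have h3' : (3 : AdjoinRoot f) = 0 := by
    rw [← map_ofNat (algebraMap R (AdjoinRoot f)) 3, h3, map_zero]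
  have hθ : θ ^ 3 = θ + AdjoinRoot.of f a := by
    have : AdjoinRoot.mk f f = 0 := AdjoinRoot.mk_self
    have h : AdjoinRoot.mk f f = θ ^ 3 - (θ + AdjoinRoot.of f a) := by
      conv_lhs => enter [2]; dsimp only [f]
      simp only [map_sub, map_add, map_pow]; rfl
    rw [← sub_eq_zero, ← h, this]
  let U : Matrix (Fin 3) (Fin 3) (AdjoinRoot f) := !![θ, 0, 0; 0, θ + 1, 0; 0, 0, θ + 2]
  let V : Matrix (Fin 3) (Fin 3) (AdjoinRoot f) := !![0, 1, 0; 0, 0, 1; AdjoinRoot.of f b, 0, 0]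
  have hinj : Function.Injective (algebraMap R (Matrix (Fin 3) (Fin 3) (AdjoinRoot f))) := by
    intro r s hrs
    have h := congrFun (congrFun hrs 0) 0
    simp only [Matrix.algebraMap_matrix_apply, if_true] at h
    exact FaithfulSMul.algebraMap_injective R (AdjoinRoot f) h
  let φ : SymbolAlg 3 R a b →ₐ[R] Matrix (Fin 3) (Fin 3) (AdjoinRoot f) := lift U V
    (by
      ext i j
      fin_cases i <;> fin_cases j <;>
        simp [U, pow_three, Matrix.algebraMap_matrix_apply]
      · linear_combination hθ
      · linear_combination hθ + (θ ^ 2 + θ) * h3'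
      · linear_combination hθ + (2 * θ ^ 2 + 4 * θ + 2) * h3')
    (by
      ext i j
      fin_cases i <;> fin_cases j <;>
        simp [V, pow_three, Matrix.mul_apply, Fin.sum_univ_three, Matrix.algebraMap_matrix_apply])
    (by
      ext i j
      fin_cases i <;> fin_cases j <;>
        simp [U, V]
      · ring
      · linear_combination (-AdjoinRoot.of f b) * h3')
  refine Function.Injective.of_comp (f := φ) ?_
  convert hinj
  ext r : 1
  exact φ.commutes r

lemma sandwichDual (hb : IsUnit b) :
    SandwichDual R (symbolFamily (u 3 R a b) (v 3 R a b)) :=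
  sandwichDual_symbolFamily (by
    rw [← map_ofNat (algebraMap R (SymbolAlg 3 R a b)) 3, h3, map_zero]) hb
    (u_pow_sub_u 3 R a b) (v_pow 3 R a b) (v_mul_u_sub 3 R a b) (adjoin_eq_top 3 R a b)

end Degree3

section Field

variable {K : Type*} [Field K] [CharP K 3] (a : K) {b : K} (hb : b ≠ 0)

lemma three_eq_zero : (3 : K) = 0 := by exact_mod_cast CharP.cast_eq_zero K 3

instance : Nontrivial (SymbolAlg 3 K a b) :=
  (algebraMap_injective (three_eq_zero (K := K)) a).nontrivial

include hb

lemma isSimpleRing : IsSimpleRing (SymbolAlg 3 K a b) :=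
  (sandwichDual three_eq_zero a hb.isUnit).isSimpleRing

lemma finrank_eq_nine : Module.finrank K (SymbolAlg 3 K a b) = 9 := by
  rw [(sandwichDual three_eq_zero a hb.isUnit).finrank_eq
    (algebraMap_injective three_eq_zero a)]
  rfl

lemma isCentral : Algebra.IsCentral K (SymbolAlg 3 K a b) where
  out z hz := (sandwichDual three_eq_zero a hb.isUnit).mem_range_algebraMap_of_central
    (i₀ := (0, 0)) (by simp [symbolFamily]) (Subalgebra.mem_center_iff.1 hz)

end Field

end SymbolAlg

/-! ### Commutator identities in characteristic 3 -/

section NoncommutativeIdentities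

variable {B : Type*} [Ring B]

lemma mul_sq_of_commutator {x z c : B} (h : x * z = z * x + c) (hc : c * z = z * c) :
    x * z ^ 2 = z ^ 2 * x + 2 * (z * c) := by
  calc x * z ^ 2 = x * z * z := by noncomm_ring
    _ = z * (x * z) + c * z := by rw [h, add_mul, mul_assoc]; rw [h]
    _ = _ := by rw [h, hc]; noncomm_ring

lemma commute_cube_of_commutator (h3 : (3 : B) = 0) {x z c : B} (h : x * z = z * x + c)
    (hc : c * z = z * c) : x * z ^ 3 = z ^ 3 * x := by
  calc x * z ^ 3 = x * z ^ 2 * z := by noncomm_ring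
    _ = z ^ 2 * (x * z) + 2 * (z * (c * z)) := by rw [mul_sq_of_commutator h hc]; noncomm_ring
    _ = z ^ 3 * x + 3 * (z ^ 2 * c) := by rw [h, hc]; noncomm_ring
    _ = _ := by rw [h3]; noncomm_ring

/-- Jacobson's formula for the cube of a sum, with `[q, [p, q]] = 0`, so that only `[p, [p, q]] = s`
survives. -/
lemma cube_add_of_commutator (h3 : (3 : B) = 0) {p q r s : B} (hpq : p * q = q * p + r)
    (hpr : p * r = r * p + s) (hqr : q * r = r * q) : (p + q) ^ 3 = p ^ 3 + q ^ 3 + s := by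
  have hr : r = p * q - q * p := by rw [hpq]; abel
  have hs : s = p * r - r * p := by rw [hpr]; abel
  have h0 : q * (p * q - q * p) - (p * q - q * p) * q = 0 := by rw [← hr, hqr, sub_self]
  calc (p + q) ^ 3 = p ^ 3 + q ^ 3 + (p * (p * q - q * p) - (p * q - q * p) * p)
        - (q * (p * q - q * p) - (p * q - q * p) * q) + 3 * (p * q * p + q * p * q) := by
        noncomm_ring
    _ = _ := by rw [h0, h3, hs, hr]; noncomm_ring

lemma sum_eq_double_commutator (h3 : (3 : B) = 0) (x y : B) :
    x * x * y + x * y * x + y * x * x = x * (x * y - y * x) - (x * y - y * x) * x := by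
  calc _ = x * (x * y - y * x) - (x * y - y * x) * x + 3 * (x * y * x) := by noncomm_ring
    _ = _ := by rw [h3]; noncomm_ring

end NoncommutativeIdentities

/-! ### From the Clifford relations to the Weyl relations and back -/

section Relations

variable {F : Type*} [Field F] {B : Type*} [Ring B] [Algebra F B]

lemma cube_smul_add_smul (a b : F) (x y : B) :
    (a • x + b • y) ^ 3 = a ^ 3 • x ^ 3 + (a ^ 2 * b) • (x * x * y + x * y * x + y * x * x) +
      (a * b ^ 2) • (x * y * y + y * x * y + y * y * x) + b ^ 3 • y ^ 3 := by
  simp only [pow_three, mul_add, add_mul, smul_mul_assoc, mul_smul_comm, mul_assoc]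
  module

lemma sub_cube_smul_sq (β : F) (z : B) : (z ^ 3 - β ^ 3 • 1) ^ 2 =
    (z ^ 3) ^ 2 - (2 * β ^ 3) • z ^ 3 + (β ^ 6) • 1 := by
  rw [pow_two (z ^ 3 - β ^ 3 • 1), mul_sub, sub_mul, sub_mul]
  simp only [smul_mul_assoc, mul_smul_comm, mul_one, one_mul]
  rw [pow_two (z ^ 3)]
  module

/-- The relations of `C_Φ` in terms of `x`, `z = y₁` and the central element `w`. -/
structure WeylRel (α β γ δ : F) (x z w : B) : Prop where
  mul_eq : x * z = z * x + β • 1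
  cube : x ^ 3 = α • 1
  comm_x : w * x = x * w
  comm_z : w * z = z * w
  curve : (z ^ 3 - β ^ 3 • 1) ^ 2 = w ^ 3 + CPhi.Δ α β γ δ • 1

variable [CharP F 3]

variable (F B) in
include F in
lemma three_eq_zero_of_algebra : (3 : B) = 0 := by
  rw [← map_ofNat (algebraMap F B) 3, SymbolAlg.three_eq_zero, map_zero]

variable {α β γ δ : F}

/-- The element being cubed plays the role of `β y`. Since `w` is central, the only correction to
additivity of cubes is the double commutator of `γ x` with `z ^ 2 + β z`, namely `2 γ ^ 2 β ^ 2`. -/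
lemma cube_sub_of_weyl {x z w : B} (hxz : x * z = z * x + β • 1) (hx : x ^ 3 = α • 1)
    (hwx : w * x = x * w) (hwz : w * z = z * w) :
    (w - (γ • x + (z ^ 2 + β • z))) ^ 3 =
      w ^ 3 - (z ^ 3) ^ 2 - β ^ 3 • z ^ 3 - (γ ^ 3 * α - γ ^ 2 * β ^ 2) • 1 := by
  have h3 := three_eq_zero_of_algebra F B
  have h3F : (3 : F) = 0 := SymbolAlg.three_eq_zero
  have hchar : ∀ p q : B, p * q = q * p → (p - q) ^ 3 = p ^ 3 - q ^ 3 := by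
    intro p q h
    rw [sub_eq_add_neg, cube_add_of_commutator h3 (r := 0) (s := 0) (by simp [h]) (by simp)
      (by simp)]
    noncomm_ring
  have hchar' : ∀ p q : B, p * q = q * p → (p + q) ^ 3 = p ^ 3 + q ^ 3 := by
    intro p q h
    rw [cube_add_of_commutator h3 (r := 0) (s := 0) (by simp [h]) (by simp) (by simp), add_zero]
  have hxz2 : x * z ^ 2 = z ^ 2 * x + 2 * (z * (β • 1)) := mul_sq_of_commutator hxz (by simp)
  have hq : (γ • x + (z ^ 2 + β • z)) ^ 3 =
      (γ • x) ^ 3 + (z ^ 2 + β • z) ^ 3 + (2 * γ ^ 2 * β ^ 2) • 1 := by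
    refine cube_add_of_commutator h3 (r := γ • ((2 * β) • z + β ^ 2 • 1)) ?_ ?_ ?_
    · simp only [mul_add, add_mul, smul_mul_assoc, mul_smul_comm, hxz, hxz2, two_mul, mul_one]
      module
    · simp only [mul_add, add_mul, smul_mul_assoc, mul_smul_comm, hxz, mul_one, one_mul]
      module
    · simp only [mul_add, add_mul, smul_mul_assoc, mul_smul_comm, mul_one, one_mul, pow_two,
        mul_assoc]
      module
  have hwz2 : w * z ^ 2 = z ^ 2 * w := ((show Commute w z from hwz).pow_right 2).eq
  rw [hchar _ _ (by simp only [mul_add, add_mul, smul_mul_assoc, mul_smul_comm, hwx, hwz, hwz2]),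
    hq, hchar' (z ^ 2) _ (by simp [pow_two, mul_assoc]), smul_pow, smul_pow, hx, ← pow_mul,
    ← pow_mul]
  linear_combination (norm := module) (-(γ ^ 2 * β ^ 2 * h3F)) • (1 : B)

section

variable {x y : B}
  (hrel : ∀ a b : F, (a • x + b • y) ^ 3 =
    (α * a ^ 3 + β * a ^ 2 * b + γ * a * b ^ 2 + δ * b ^ 3) • 1)

include hrel

lemma mixed_relations_of_cube :
    x * x * y + x * y * x + y * x * x = β • 1 ∧ x * y * y + y * x * y + y * y * x = γ • 1 := by
  -- The points `(1, 1)` and `(1, -1)` already separate the two mixed terms, even over the field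
  -- with three elements.
  have h1 := hrel 1 1
  have h2 := hrel 1 (-1)
  have hx : x ^ 3 = α • 1 := by simpa using hrel 1 0
  have hy : y ^ 3 = δ • 1 := by simpa using hrel 0 1
  have h3F : (3 : F) = 0 := SymbolAlg.three_eq_zero
  rw [cube_smul_add_smul, hx, hy] at h1 h2
  constructor
  · linear_combination (norm := module) (2 : F) • h1 - (2 : F) • h2 -
      h3F • (x * x * y + x * y * x + y * x * x) + (β * h3F) • (1 : B)
  · linear_combination (norm := module) (2 : F) • h1 + (2 : F) • h2 -
      h3F • (x * y * y + y * x * y + y * y * x) + (γ * h3F) • (1 : B)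

lemma commutators_of_cube {z : B} (hz : z = ⁅x, y⁆ + ⁅x, ⁅x, y⁆⁆) :
    x * y = y * x + (z - β • 1) ∧ x * z = z * x + β • 1 ∧ y * z = z * y + (-γ) • 1 := by
  have h3 := three_eq_zero_of_algebra F B
  obtain ⟨h1, h2⟩ := mixed_relations_of_cube hrel
  have h2' : y * y * x + y * x * y + x * y * y = γ • 1 := by rw [← h2]; abel
  rw [sum_eq_double_commutator h3] at h1 h2'
  rw [Ring.lie_def, Ring.lie_def, h1] at hz
  have hxy : x * y - y * x = z - β • 1 := by rw [hz]; abel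
  refine ⟨by rw [← hxy]; abel, ?_, ?_⟩
  · rw [hz, mul_add, add_mul, sub_eq_iff_eq_add.1 h1]
    simp
    abel
  · rw [hz, mul_add, add_mul, neg_smul, ← h2']
    simp only [mul_sub, sub_mul, mul_smul_comm, smul_mul_assoc, mul_one, one_mul]
    abel

lemma weylRel_of_cube {z w : B} (hz : z = ⁅x, y⁆ + ⁅x, ⁅x, y⁆⁆)
    (hw : w = β • (y + z) + γ • x + z ^ 2) : WeylRel α β γ δ x z w := by
  obtain ⟨hxy, hxz, hyz⟩ := commutators_of_cube hrel hz
  have hx : x ^ 3 = α • 1 := by simpa using hrel 1 0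
  have hy : y ^ 3 = δ • 1 := by simpa using hrel 0 1
  have h3F : (3 : F) = 0 := SymbolAlg.three_eq_zero
  have hxz2 : x * z ^ 2 = z ^ 2 * x + 2 * (z * (β • 1)) := mul_sq_of_commutator hxz (by simp)
  have hyz2 : y * z ^ 2 = z ^ 2 * y + 2 * (z * ((-γ) • 1)) := mul_sq_of_commutator hyz (by simp)
  have hwx : w * x = x * w := by
    rw [hw]
    simp only [mul_add, add_mul, smul_mul_assoc, mul_smul_comm, hxy, hxz, hxz2, two_mul, mul_one]
    linear_combination (norm := module) (-(β * h3F)) • z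
  have hwy : w * y = y * w := by
    rw [hw]
    simp only [mul_add, add_mul, smul_mul_assoc, mul_smul_comm, hxy, hyz, hyz2, two_mul, mul_one]
    linear_combination (norm := module) (γ * h3F) • z
  have hwz : w * z = z * w := by
    have h1 : Commute w (x * y) := .mul_right hwx hwy
    have h2 : Commute w (y * x) := .mul_right hwy hwx
    have hz' : z = x * y - y * x + β • 1 := by rw [hxy]; abel
    rw [hz']
    exact ((h1.sub_right h2).add_right ((Commute.one_right w).smul_right β)).eq
  refine ⟨hxz, hx, hwx, hwz, ?_⟩
  have hcube := cube_sub_of_weyl (γ := γ) hxz hx hwx hwz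
  have hβy : w - (γ • x + (z ^ 2 + β • z)) = β • y := by rw [hw]; module
  rw [hβy, smul_pow, hy] at hcube
  rw [sub_cube_smul_sq, CPhi.Δ]
  linear_combination (norm := module) hcube - (β ^ 3 * h3F) • z ^ 3

end

variable (α β γ δ) in
lemma CPhi.weylRel :
    WeylRel α β γ δ (CPhi.x α β γ δ) (CPhi.y₁ α β γ δ) (CPhi.w α β γ δ) :=
  weylRel_of_cube (x := CPhi.x α β γ δ) (y := CPhi.y α β γ δ)
    (fun a b ↦ by
      simpa [x, y, Algebra.algebraMap_eq_smul_one] using!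
        RingQuot.mkAlgHom_rel F (CliffordRel.rel (α := α) (β := β) (γ := γ) (δ := δ) a b))
    rfl rfl

/-- The universal property of `C_Φ` in terms of `x`, `y₁` and `w`. -/
lemma WeylRel.exists_lift {x z w : B} (hβ : β ≠ 0) (h : WeylRel α β γ δ x z w) :
    ∃ φ : CPhi α β γ δ →ₐ[F] B,
      φ (CPhi.x α β γ δ) = x ∧ φ (CPhi.y₁ α β γ δ) = z ∧ φ (CPhi.w α β γ δ) = w := by
  have h3 := three_eq_zero_of_algebra F B
  have h3F : (3 : F) = 0 := SymbolAlg.three_eq_zero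
  -- Solves `w = β (y + z) + γ x + z ^ 2` for `y`.
  set y : B := β⁻¹ • (w - (γ • x + (z ^ 2 + β • z))) with hy
  have hβy : β • y = w - (γ • x + (z ^ 2 + β • z)) := by rw [hy, smul_inv_smul₀ hβ]
  have hcancel : ∀ p q : B, β • p = β • q → p = q := fun p q h ↦ smul_right_injective B hβ h
  have hxz := h.mul_eq
  have hxz2 : x * z ^ 2 = z ^ 2 * x + 2 * (z * (β • 1)) := mul_sq_of_commutator hxz (by simp)
  have hxy : x * y - y * x = z - β • 1 := by
    apply hcancel
    rw [smul_sub, ← mul_smul_comm, ← smul_mul_assoc, hβy]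
    simp only [mul_sub, sub_mul, mul_add, add_mul, smul_mul_assoc, mul_smul_comm, hxz, hxz2,
      h.comm_x, two_mul, mul_one]
    linear_combination (norm := module) (-(β * h3F)) • z
  have hyz : y * z - z * y = -(γ • 1) := by
    apply hcancel
    rw [smul_sub, ← smul_mul_assoc, ← mul_smul_comm β z, hβy]
    simp only [mul_sub, sub_mul, mul_add, add_mul, smul_mul_assoc, mul_smul_comm, hxz,
      h.comm_z, ← pow_succ, ← pow_succ']
    module
  have hy3 : y ^ 3 = δ • 1 := by
    have hcube := cube_sub_of_weyl (γ := γ) hxz h.cube h.comm_x h.comm_z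
    have hcurve := h.curve
    rw [sub_cube_smul_sq, CPhi.Δ] at hcurve
    rw [← hβy, smul_pow] at hcube
    apply smul_right_injective B (pow_ne_zero 3 hβ)
    linear_combination (norm := module) hcube - hcurve - (β ^ 3 * h3F) • z ^ 3
  have h1 : x * x * y + x * y * x + y * x * x = β • 1 := by
    rw [sum_eq_double_commutator h3, hxy, mul_sub, sub_mul, hxz]
    simp
  have h2 : x * y * y + y * x * y + y * y * x = γ • 1 := by
    have : x * y * y + y * x * y + y * y * x = y * y * x + y * x * y + x * y * y := by abel
    rw [this, sum_eq_double_commutator h3, ← neg_sub (x * y), hxy]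
    rw [neg_sub, mul_sub, sub_mul, ← neg_inj, ← hyz]
    simp
  let φ : CPhi α β γ δ →ₐ[F] B := RingQuot.liftAlgHom F ⟨FreeAlgebra.lift F ![x, y], by
    rintro _ _ ⟨a, b⟩
    rw [AlgHom.commutes, Algebra.algebraMap_eq_smul_one]
    simp only [map_pow, map_add, map_smul, FreeAlgebra.lift_ι_apply,
      Matrix.cons_val_zero, Matrix.cons_val_one]
    rw [cube_smul_add_smul, h1, h2, h.cube, hy3]
    module⟩
  have hφx : φ (CPhi.x α β γ δ) = x := by simp [φ, CPhi.x]
  have hφy : φ (CPhi.y α β γ δ) = y := by simp [φ, CPhi.y]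
  have hφz : φ (CPhi.y₁ α β γ δ) = z := by
    simp only [CPhi.y₁, Ring.lie_def, map_add, map_sub, map_mul, hφx, hφy, hxy]
    rw [mul_sub, sub_mul, hxz]
    simp
  refine ⟨φ, hφx, hφz, ?_⟩
  simp only [CPhi.w, CPhi.y₂, map_add, map_smul, map_pow, hφx, hφy, hφz, smul_add, hβy]
  abel

end Relations

/-! ### Weyl relations and symbol relations -/

section Weyl

variable {F : Type*} [Field F] [CharP F 3] {B : Type*} [Ring B] [Algebra F B]
  {α β γ δ : F}

/-- `β⁻¹ z x` and `x` satisfy the relations of a symbol algebra. -/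
lemma WeylRel.symbol {x z w : B} (hβ : β ≠ 0) (h : WeylRel α β γ δ x z w) :
    x * (β⁻¹ • (z * x)) - (β⁻¹ • (z * x)) * x = x ∧
      (β⁻¹ • (z * x)) ^ 3 - β⁻¹ • (z * x) = (α * (β ^ 3)⁻¹) • z ^ 3 := by
  have h3F : (3 : F) = 0 := SymbolAlg.three_eq_zero
  have hxz := h.mul_eq
  constructor
  · rw [mul_smul_comm, ← mul_assoc, hxz, smul_mul_assoc, add_mul, smul_add, smul_mul_assoc,
      inv_smul_smul₀ hβ]
    simp
  · have hxz' : ∀ t, x * (z * t) = z * (x * t) + β • t := fun t ↦ by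
      rw [← mul_assoc, hxz, add_mul, smul_mul_assoc, one_mul, mul_assoc]
    have key : (z * x) ^ 3 = z ^ 3 * x ^ 3 + β ^ 2 • (z * x) := by
      simp only [pow_three, mul_assoc, hxz', mul_add, mul_smul_comm]
      linear_combination (norm := module) (β * h3F) • (z * (z * (x * x)))
    rw [smul_pow, key, h.cube, mul_smul_comm, mul_one, smul_add, smul_smul, smul_smul,
      show β⁻¹ ^ 3 * β ^ 2 = β⁻¹ by field_simp, inv_pow, mul_comm α]
    abel

/-- The relations of `C_Φ` hold in a symbol algebra. -/
lemma weylRel_of_symbol {u v s w : B} (hα : α ≠ 0) (hβ : β ≠ 0)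
    (hu : u ^ 3 - u = (α * (β ^ 3)⁻¹) • (s + β ^ 3 • 1)) (hv : v ^ 3 = α • 1)
    (huv : v * u - u * v = v) (hwu : w * u = u * w) (hwv : w * v = v * w)
    (hcurve : s ^ 2 = w ^ 3 + CPhi.Δ α β γ δ • 1) :
    WeylRel α β γ δ v ((β * α⁻¹) • (u * v ^ 2)) w ∧
      ((β * α⁻¹) • (u * v ^ 2)) ^ 3 = s + β ^ 3 • 1 := by
  have h3F : (3 : F) = 0 := SymbolAlg.three_eq_zero
  have hvu : v * u = u * v + v := by rw [mul_eq_add_of_commutator huv]; noncomm_ring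
  -- As `v ^ 3 = α`, this element is `β u v⁻¹`, the solution `z` of `u = β⁻¹ z x` with `x = v`. Its
  -- cube comes from `u (u + 2) (u + 4) = u ^ 3 - u` in characteristic 3.
  have hz : ((β * α⁻¹) • (u * v ^ 2)) ^ 3 = s + β ^ 3 • 1 := by
    have hvu' : ∀ t, v * (u * t) = u * (v * t) + v * t := fun t ↦ by
      rw [← mul_assoc, hvu, add_mul, mul_assoc]
    have key : (u * v ^ 2) ^ 3 = (u ^ 3 - u) * v ^ 3 * v ^ 3 := by
      simp only [pow_three, pow_two, mul_assoc, hvu', mul_add, sub_mul]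
      linear_combination (norm := module) (2 * h3F) • (u * (u * (v * (v * (v * (v * (v * v))))))) +
        (3 * h3F) • (u * (v * (v * (v * (v * (v * v))))))
    rw [smul_pow, key, hu, hv]
    simp only [mul_smul_comm, mul_one, smul_smul]
    rw [show (β * α⁻¹) ^ 3 * (α * (α * (α * (β ^ 3)⁻¹))) = 1 by field_simp, one_smul]
  refine ⟨⟨?_, hv, hwv, ?_, ?_⟩, hz⟩
  · rw [mul_smul_comm, ← mul_assoc, hvu, smul_mul_assoc, add_mul, smul_add, mul_assoc, mul_assoc,
      ← pow_succ', ← pow_succ, hv, smul_smul, inv_mul_cancel_right₀ hα]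
  · have : Commute w (u * v ^ 2) := Commute.mul_right hwu (Commute.pow_right hwv 2)
    exact (this.smul_right _).eq
  · rw [hz, add_sub_cancel_right, hcurve]

end Weyl

/-! ### The coordinate ring of the cubic -/

namespace CubicCoordinateRing

open WeierstrassCurve.Affine

variable {F : Type*} [Field F] (D : F)

/-- The coordinate function `r` on `E_D`. -/
noncomputable def r : (cubicCurve D).CoordinateRing := CoordinateRing.mk _ (.C .X)

/-- The coordinate function `s` on `E_D`. -/
noncomputable def s : (cubicCurve D).CoordinateRing := CoordinateRing.mk _ .X

lemma s_sq : s D ^ 2 = r D ^ 3 + algebraMap F _ D := by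
  have h : CoordinateRing.mk (cubicCurve D) (.X ^ 2 - .C (.X ^ 3 + .C D)) = 0 := by
    convert (AdjoinRoot.mk_self : CoordinateRing.mk (cubicCurve D) (cubicCurve D).polynomial = 0)
    simp [WeierstrassCurve.Affine.polynomial, cubicCurve]
  rw [map_sub, sub_eq_zero, Polynomial.C_add, Polynomial.C_pow] at h
  simpa only [map_pow, map_add] using! h

lemma adjoin_eq_top : Algebra.adjoin F {r D, s D} = ⊤ := by
  rw [eq_top_iff]
  rintro g -
  obtain ⟨g, rfl⟩ := AdjoinRoot.mk_surjective g
  induction g using Polynomial.induction_on' with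
  | add p q hp hq => simpa using add_mem hp hq
  | monomial n p =>
    rw [← Polynomial.C_mul_X_pow_eq_monomial, map_mul, map_pow]
    refine mul_mem ?_ (pow_mem (Algebra.subset_adjoin (by right; rfl)) n)
    induction p using Polynomial.induction_on' with
    | add p q hp hq => simpa using add_mem hp hq
    | monomial n c =>
      rw [← Polynomial.C_mul_X_pow_eq_monomial, map_mul, map_mul, map_pow, map_pow]
      exact mul_mem (Subalgebra.algebraMap_mem _ c)
        (pow_mem (Algebra.subset_adjoin (by left; rfl)) n)

variable {D} {K : Type*} [CommRing K] [Algebra F K]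

lemma algHom_ext {B : Type*} [Semiring B] [Algebra F B]
    {f g : (cubicCurve D).CoordinateRing →ₐ[F] B} (hr : f (r D) = g (r D))
    (hs : f (s D) = g (s D)) : f = g :=
  AlgHom.ext_of_adjoin_eq_top (adjoin_eq_top D) (by
    rintro _ (rfl | rfl)
    exacts [hr, hs])

lemma exists_lift {r₀ s₀ : K} (h : s₀ ^ 2 = r₀ ^ 3 + algebraMap F K D) :
    ∃ f : (cubicCurve D).CoordinateRing →ₐ[F] K, f (r D) = r₀ ∧ f (s D) = s₀ := by
  let f : (cubicCurve D).CoordinateRing →ₐ[F] K :=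
    AdjoinRoot.liftAlgHom _ (Polynomial.aeval r₀) s₀ (by
      rw [show (cubicCurve D).polynomial = .X ^ 2 - .C (.X ^ 3 + .C D) by
        simp [WeierstrassCurve.Affine.polynomial, cubicCurve]]
      rw [Polynomial.eval₂_sub, Polynomial.eval₂_pow, Polynomial.eval₂_C, Polynomial.eval₂_X, h]
      simp)
  refine ⟨f, (AdjoinRoot.liftAlgHom_mk _ _ _ _ _).trans ?_,
    (AdjoinRoot.liftAlgHom_mk _ _ _ _ _).trans ?_⟩
  · rw [Polynomial.eval₂_C]; simp
  · rw [Polynomial.eval₂_X]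

end CubicCoordinateRing

/-! ### Specialization of the Clifford algebra to symbol algebras -/

namespace CPhi

variable {F : Type*} [Field F] [CharP F 3] {α β : F} (γ δ : F) {R : Type*} [CommRing R]
  [Algebra F R]

lemma exists_algHom_of_symbol {B : Type*} [Ring B] [Algebra F B] [Algebra R B]
    [IsScalarTower F R B] (hα : α ≠ 0) (hβ : β ≠ 0) {r s : R}
    (h : s ^ 2 = r ^ 3 + algebraMap F R (Δ α β γ δ)) {u v : B}
    (hu : u ^ 3 - u = algebraMap R B (algebraMap F R (α * (β ^ 3)⁻¹) *
      (s + algebraMap F R (β ^ 3))))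
    (hv : v ^ 3 = algebraMap R B (algebraMap F R α)) (huv : v * u - u * v = v) :
    ∃ φ : CPhi α β γ δ →ₐ[F] B, φ (w α β γ δ) = algebraMap R B r ∧
      φ (y₁ α β γ δ ^ 3 - algebraMap F _ (β ^ 3)) = algebraMap R B s ∧
      (Algebra.adjoin F {r, s} = ⊤ → Algebra.adjoin R {u, v} = ⊤ → Function.Surjective φ) := by
  have hF : ∀ c : F, algebraMap R B (algebraMap F R c) = c • 1 := fun c ↦ by
    rw [← IsScalarTower.algebraMap_apply, Algebra.algebraMap_eq_smul_one]
  rw [hF] at hv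
  rw [map_mul, map_add, hF, hF, smul_mul_assoc, one_mul] at hu
  obtain ⟨hw, hz⟩ := weylRel_of_symbol (γ := γ) (δ := δ) (w := algebraMap R B r) hα hβ hu hv huv
    (Algebra.commutes _ _) (Algebra.commutes _ _) (by rw [← map_pow, h, map_add, map_pow, hF])
  obtain ⟨φ, hφx, hφz, hφw⟩ := hw.exists_lift hβ
  have hφs : φ (y₁ α β γ δ ^ 3 - algebraMap F _ (β ^ 3)) = algebraMap R B s := by
    rw [map_sub, map_pow, hφz, hz, AlgHom.commutes,
      Algebra.algebraMap_eq_smul_one (β ^ 3), add_sub_cancel_right]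
  refine ⟨φ, hφw, hφs, fun hgen hgen' ↦ ?_⟩
  rw [← AlgHom.range_eq_top, eq_top_iff]
  have hv' : v ∈ φ.range := ⟨_, hφx⟩
  have hR : ∀ c : R, algebraMap R B c ∈ φ.range := by
    intro c
    have hc : c ∈ Algebra.adjoin F {r, s} := hgen ▸ Algebra.mem_top
    induction hc using Algebra.adjoin_induction with
    | mem x hx =>
      rcases hx with rfl | rfl
      exacts [⟨_, hφw⟩, ⟨_, hφs⟩]
    | algebraMap c =>
      rw [← IsScalarTower.algebraMap_apply]
      exact φ.range.algebraMap_mem c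
    | add x y _ _ hx hy => rw [map_add]; exact add_mem hx hy
    | mul x y _ _ hx hy => rw [map_mul]; exact mul_mem hx hy
  -- Inverts the substitution: `u = β⁻¹ z v`, where `z` is the image of `y₁`.
  have hu' : u ∈ φ.range := by
    have h1 : β⁻¹ • (((β * α⁻¹) • (u * v ^ 2)) * v) = u := by
      rw [smul_mul_assoc, mul_assoc, ← pow_succ, hv, mul_smul_comm, mul_one, smul_smul, smul_smul,
        show β⁻¹ * (β * α⁻¹) * α = 1 by field_simp, one_smul]
    rw [← h1]
    exact Subalgebra.smul_mem _ (mul_mem (⟨_, hφz⟩ : _ ∈ φ.range) hv') _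
  rintro t -
  have ht : t ∈ Algebra.adjoin R {u, v} := hgen' ▸ Algebra.mem_top
  induction ht using Algebra.adjoin_induction with
  | mem x hx =>
    rcases hx with rfl | rfl
    exacts [hu', hv']
  | algebraMap c => exact hR c
  | add x y _ _ hx hy => exact add_mem hx hy
  | mul x y _ _ hx hy => exact mul_mem hx hy

/-- A solution of `s ^ 2 = r ^ 3 + Δ` in `R` maps `C_Φ` to a symbol algebra over `R`. -/
lemma exists_toSymbol (hα : α ≠ 0) (hβ : β ≠ 0) {r s : R}
    (h : s ^ 2 = r ^ 3 + algebraMap F R (Δ α β γ δ)) :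
    ∃ φ : CPhi α β γ δ →ₐ[F] SymbolAlg 3 R
        (algebraMap F R (α * (β ^ 3)⁻¹) * (s + algebraMap F R (β ^ 3))) (algebraMap F R α),
      φ (w α β γ δ) = algebraMap R _ r ∧
      φ (y₁ α β γ δ ^ 3 - algebraMap F _ (β ^ 3)) = algebraMap R _ s ∧
      (Algebra.adjoin F {r, s} = ⊤ → Function.Surjective φ) := by
  obtain ⟨φ, hw, hs, hsurj⟩ := exists_algHom_of_symbol γ δ hα hβ h
    (SymbolAlg.u_pow_sub_u 3 R _ _) (SymbolAlg.v_pow 3 R _ _) (SymbolAlg.v_mul_u_sub 3 R _ _)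
  exact ⟨φ, hw, hs, fun hgen ↦ hsurj hgen (SymbolAlg.adjoin_eq_top 3 R _ _)⟩

end CPhi

/-! ### The dual family for an algebra generated by `x, z, w` -/

section Generic

variable {F : Type*} [Field F] {B : Type*} [Ring B] [Algebra F B]
  {α β γ δ : F} {x z w : B}

lemma mul_comm_of_adjoin_eq_top {s : Set B} (hs : Algebra.adjoin F s = ⊤) {c : B}
    (hc : ∀ t ∈ s, t * c = c * t) (t : B) : t * c = c * t := by
  have ht : t ∈ Algebra.adjoin F s := hs ▸ Algebra.mem_top
  induction ht using Algebra.adjoin_induction with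
  | mem t ht => exact hc t ht
  | algebraMap a => exact Algebra.commutes a c
  | add t u _ _ ht hu => rw [add_mul, mul_add, ht, hu]
  | mul t u _ _ ht hu => rw [mul_assoc, hu, ← mul_assoc, ht, mul_assoc]

lemma WeylRel.mul_comm_w (h : WeylRel α β γ δ x z w)
    (hgen : Algebra.adjoin F {x, z, w} = ⊤) (t : B) : t * w = w * t := by
  refine mul_comm_of_adjoin_eq_top hgen ?_ t
  rintro _ (rfl | rfl | rfl)
  exacts [h.comm_x.symm, h.comm_z.symm, rfl]

lemma adjoin_x_z_w_eq_top {y : B} (hβ : β ≠ 0) (hgen : Algebra.adjoin F {x, y} = ⊤)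
    (hw : w = β • (y + z) + γ • x + z ^ 2) : Algebra.adjoin F {x, z, w} = ⊤ := by
  set S := Algebra.adjoin F {x, z, w}
  have hx : x ∈ S := Algebra.subset_adjoin (by simp)
  have hz : z ∈ S := Algebra.subset_adjoin (by simp)
  have hwS : w ∈ S := Algebra.subset_adjoin (by simp)
  have hy : y ∈ S := by
    have : y = β⁻¹ • (w - γ • x - z ^ 2) - z := by
      rw [eq_sub_iff_add_eq, eq_inv_smul_iff₀ hβ, hw]
      abel
    rw [this]
    exact sub_mem (S.smul_mem (sub_mem (sub_mem hwS (S.smul_mem hx _)) (pow_mem hz 2)) _) hz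
  rw [eq_top_iff, ← hgen, Algebra.adjoin_le_iff]
  rintro _ (rfl | rfl)
  exacts [hx, hy]

variable [CharP F 3]

lemma WeylRel.mul_comm_z_cube (h : WeylRel α β γ δ x z w)
    (hgen : Algebra.adjoin F {x, z, w} = ⊤) (t : B) : t * z ^ 3 = z ^ 3 * t := by
  refine mul_comm_of_adjoin_eq_top hgen ?_ t
  rintro _ (rfl | rfl | rfl)
  · exact commute_cube_of_commutator (three_eq_zero_of_algebra F B) h.mul_eq (by simp)
  · exact (Commute.self_pow _ 3).eq
  · exact (Commute.pow_right h.comm_z 3).eq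

/-- The scalars `R` need only map onto elements including `w` and `z ^ 3`. This serves both for `R`
the center and for `R` the coordinate ring, before the two are identified. -/
lemma WeylRel.sandwichDual (h : WeylRel α β γ δ x z w) (hα : α ≠ 0) (hβ : β ≠ 0)
    (hgen : Algebra.adjoin F {x, z, w} = ⊤) {R : Type*} [CommRing R] [Algebra R B] {f : F →+* R}
    (hf : ∀ c, algebraMap R B (f c) = algebraMap F B c) {r s : R} (hr : algebraMap R B r = w)
    (hs : algebraMap R B s = z ^ 3) : SandwichDual R (symbolFamily (β⁻¹ • (z * x)) x) := by
  obtain ⟨h1, h2⟩ := h.symbol hβ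
  have hx3 : x ^ 3 = algebraMap R B (f α) := by
    rw [h.cube, hf, Algebra.algebraMap_eq_smul_one]
  refine sandwichDual_symbolFamily (a := f (α * (β ^ 3)⁻¹) * s) (b := f α)
    (three_eq_zero_of_algebra F B) (hα.isUnit.map f) ?_ hx3 h1 ?_
  · rw [h2, map_mul, hf, hs, Algebra.smul_def]
  · set S := Algebra.adjoin R {β⁻¹ • (z * x), x}
    have hu : β⁻¹ • (z * x) ∈ S := Algebra.subset_adjoin (by simp)
    have hx : x ∈ S := Algebra.subset_adjoin (by simp)
    have hz : z ∈ S := by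
      have : z = algebraMap R B (f (α⁻¹ * β)) * (β⁻¹ • (z * x) * x ^ 2) := by
        rw [smul_mul_assoc, mul_assoc, ← pow_succ', h.cube, hf, ← Algebra.smul_def, smul_smul,
          mul_smul_comm, mul_one, smul_smul, show α⁻¹ * β * β⁻¹ * α = 1 by field_simp, one_smul]
      rw [this]
      exact mul_mem (S.algebraMap_mem _) (mul_mem hu (pow_mem hx 2))
    have hw : w ∈ S := hr ▸ S.algebraMap_mem r
    rw [eq_top_iff]
    rintro t -
    have ht : t ∈ Algebra.adjoin F {x, z, w} := hgen ▸ Algebra.mem_top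
    induction ht using Algebra.adjoin_induction with
    | mem t ht =>
      rcases ht with rfl | rfl | rfl
      exacts [hx, hz, hw]
    | algebraMap c => rw [← hf]; exact S.algebraMap_mem _
    | add t u _ _ ht hu => exact add_mem ht hu
    | mul t u _ _ ht hu => exact mul_mem ht hu

end Generic

/-! ### The center and the Azumaya property -/

namespace CPhi

variable {F : Type*} [Field F] {α β : F} (γ δ : F)

lemma adjoin_x_y_eq_top (α β γ δ : F) : Algebra.adjoin F {x α β γ δ, y α β γ δ} = ⊤ := by
  have hs : Function.Surjective (RingQuot.mkAlgHom F (CliffordRel α β γ δ)) :=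
    RingQuot.mkAlgHom_surjective _ _
  rw [← (AlgHom.range_eq_top _).2 hs, ← Algebra.map_top, ← FreeAlgebra.adjoin_range_ι,
    AlgHom.map_adjoin, ← Set.range_comp]
  congr 1
  ext t
  simp [x, y, Fin.exists_fin_two, eq_comm]

lemma adjoin_eq_top (hβ : β ≠ 0) :
    Algebra.adjoin F {x α β γ δ, y₁ α β γ δ, w α β γ δ} = ⊤ :=
  adjoin_x_z_w_eq_top hβ (adjoin_x_y_eq_top α β γ δ) rfl

variable [CharP F 3]

theorem isAzumaya (hα : α ≠ 0) (hβ : β ≠ 0) :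
    IsAzumaya (Subring.center (CPhi α β γ δ)) (CPhi α β γ δ) ∧
      ∀ p : PrimeSpectrum (Subring.center (CPhi α β γ δ)),
        Module.rankAtStalk (CPhi α β γ δ) p = 9 := by
  have hgen := adjoin_eq_top (α := α) γ δ hβ
  have hrel := weylRel α β γ δ
  have hw : w α β γ δ ∈ Subring.center (CPhi α β γ δ) :=
    Subring.mem_center_iff.2 (hrel.mul_comm_w hgen)
  have hz : y₁ α β γ δ ^ 3 ∈ Subring.center (CPhi α β γ δ) :=
    Subring.mem_center_iff.2 (hrel.mul_comm_z_cube hgen)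
  let f : F →+* Subring.center (CPhi α β γ δ) := (algebraMap F (CPhi α β γ δ)).codRestrict _
    fun c ↦ Subring.mem_center_iff.2 fun t ↦ (Algebra.commutes c t).symm
  have hS := hrel.sandwichDual hα hβ hgen (R := Subring.center (CPhi α β γ δ)) (f := f)
    (fun _ ↦ rfl) (r := ⟨_, hw⟩) (s := ⟨_, hz⟩) rfl rfl
  have hinj : Function.Injective (algebraMap (Subring.center (CPhi α β γ δ)) (CPhi α β γ δ)) :=
    Subtype.val_injective
  exact ⟨hS.isAzumaya hinj, fun p ↦ by rw [hS.rankAtStalk_eq hinj p]; rfl⟩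

/-- The isomorphism of the coordinate ring of `E_Δ` with the center of `C_Φ`; two-sided ideals are
determined by their intersections with the center. -/
theorem exists_centerEquiv (hα : α ≠ 0) (hβ : β ≠ 0) :
    ∃ e : (cubicCurve (Δ α β γ δ)).CoordinateRing ≃ₐ[F] Subalgebra.center F (CPhi α β γ δ),
      (e (CubicCoordinateRing.r _) : CPhi α β γ δ) = w α β γ δ ∧
      (e (CubicCoordinateRing.s _) : CPhi α β γ δ) =
        y₁ α β γ δ ^ 3 - algebraMap F (CPhi α β γ δ) (β ^ 3) ∧
      ∀ I J : TwoSidedIdeal (CPhi α β γ δ),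
        (∀ g, (e g : CPhi α β γ δ) ∈ I → (e g : CPhi α β γ δ) ∈ J) → I ≤ J := by
  have hgen := adjoin_eq_top (α := α) γ δ hβ
  have hrel := weylRel α β γ δ
  have hw : w α β γ δ ∈ Subalgebra.center F (CPhi α β γ δ) :=
    Subalgebra.mem_center_iff.2 (hrel.mul_comm_w hgen)
  have hz : y₁ α β γ δ ^ 3 ∈ Subalgebra.center F (CPhi α β γ δ) :=
    Subalgebra.mem_center_iff.2 (hrel.mul_comm_z_cube hgen)
  have hs := sub_mem hz (Subalgebra.algebraMap_mem _ (β ^ 3))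
  obtain ⟨ι, hιr, hιs⟩ := CubicCoordinateRing.exists_lift (D := Δ α β γ δ)
    (K := Subalgebra.center F (CPhi α β γ δ)) (r₀ := ⟨_, hw⟩) (s₀ := ⟨_, hs⟩) (by
      ext
      simpa [Algebra.algebraMap_eq_smul_one] using! hrel.curve)
  replace hιr : (ι (CubicCoordinateRing.r _) : CPhi α β γ δ) = w α β γ δ := by rw [hιr]
  replace hιs : (ι (CubicCoordinateRing.s _) : CPhi α β γ δ) =
      y₁ α β γ δ ^ 3 - algebraMap F (CPhi α β γ δ) (β ^ 3) := by rw [hιs]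
  have h3 : (3 : (cubicCurve (Δ α β γ δ)).CoordinateRing) = 0 := three_eq_zero_of_algebra F _
  obtain ⟨φ, hφw, hφs, -⟩ := exists_toSymbol γ δ hα hβ (CubicCoordinateRing.s_sq (Δ α β γ δ))
  -- Followed by `φ`, the map `ι` becomes the structure map of the symbol algebra over the
  -- coordinate ring, which is injective.
  have hinj : Function.Injective ι := by
    have hcomp : (φ.comp (Subalgebra.center F (CPhi α β γ δ)).val).comp ι =
        IsScalarTower.toAlgHom F _ _ :=
      CubicCoordinateRing.algHom_ext (by simpa [hιr] using hφw) (by simpa [hιs] using hφs)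
    refine Function.Injective.of_comp
      (f := φ.comp (Subalgebra.center F (CPhi α β γ δ)).val) ?_
    rw [← AlgHom.coe_comp, hcomp]
    exact SymbolAlg.algebraMap_injective h3 _
  let _ : Algebra (cubicCurve (Δ α β γ δ)).CoordinateRing (CPhi α β γ δ) :=
    ((Subalgebra.center F (CPhi α β γ δ)).val.comp ι).toRingHom.toAlgebra' fun c t ↦
      (Subalgebra.mem_center_iff.1 (ι c).2 t).symm
  have hmap : ∀ g : (cubicCurve (Δ α β γ δ)).CoordinateRing,
    algebraMap _ (CPhi α β γ δ) g = ι g := fun _ ↦ rfl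
  have hS := hrel.sandwichDual hα hβ hgen (R := (cubicCurve (Δ α β γ δ)).CoordinateRing)
    (f := algebraMap F _) (fun c ↦ by rw [hmap, AlgHom.commutes]; rfl)
    (r := CubicCoordinateRing.r _) (s := CubicCoordinateRing.s _ + algebraMap F _ (β ^ 3))
    (by rw [hmap, hιr]) (by
      rw [map_add, hmap, hmap, hιs, AlgHom.commutes]
      exact sub_add_cancel _ _)
  have hsurj : Function.Surjective ι := by
    rintro ⟨c, hc⟩
    obtain ⟨g, hg⟩ := hS.mem_range_algebraMap_of_central (i₀ := (0, 0)) (by simp [symbolFamily])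
      (Subalgebra.mem_center_iff.1 hc)
    exact ⟨g, Subtype.ext hg⟩
  exact ⟨AlgEquiv.ofBijective ι ⟨hinj, hsurj⟩, hιr, hιs, fun I J h ↦ hS.twoSidedIdeal_le h⟩

theorem center_eq_adjoin (hα : α ≠ 0) (hβ : β ≠ 0) : Subalgebra.center F (CPhi α β γ δ) =
    Algebra.adjoin F {w α β γ δ, y₁ α β γ δ ^ 3} := by
  obtain ⟨e, her, hes, -⟩ := exists_centerEquiv γ δ hα hβ
  have hgen := adjoin_eq_top (α := α) γ δ hβ
  have hrel := weylRel α β γ δ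
  apply le_antisymm
  · intro c hc
    obtain ⟨g, hg⟩ := e.surjective ⟨c, hc⟩
    obtain rfl : (e g : CPhi α β γ δ) = c := congrArg Subtype.val hg
    have hg' : g ∈ Algebra.adjoin F {CubicCoordinateRing.r _, CubicCoordinateRing.s _} :=
      CubicCoordinateRing.adjoin_eq_top (Δ α β γ δ) ▸ Algebra.mem_top
    clear hg hc
    induction hg' using Algebra.adjoin_induction with
    | mem t ht =>
      rcases ht with rfl | rfl
      · rw [her]
        exact Algebra.subset_adjoin (by simp)
      · rw [hes]
        exact sub_mem (Algebra.subset_adjoin (by simp)) (Subalgebra.algebraMap_mem _ _)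
    | algebraMap a =>
      rw [AlgEquiv.commutes]
      exact Subalgebra.algebraMap_mem _ a
    | add t u _ _ ht hu => simpa using add_mem ht hu
    | mul t u _ _ ht hu => simpa using mul_mem ht hu
  · rw [Algebra.adjoin_le_iff]
    rintro _ (rfl | rfl)
    exacts [Subalgebra.mem_center_iff.2 (hrel.mul_comm_w hgen),
      Subalgebra.mem_center_iff.2 (hrel.mul_comm_z_cube hgen)]

end CPhi

/-- The quotient by the kernel of a surjective algebra homomorphism. -/
noncomputable def TwoSidedIdeal.quotientKerAlgEquiv {F A B : Type*} [CommRing F] [Ring A] [Ring B]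
    [Algebra F A] [Algebra F B] (φ : A →ₐ[F] B) (hφ : Function.Surjective φ) :
    (TwoSidedIdeal.ker φ).ringCon.Quotient ≃ₐ[F] B :=
  AlgEquiv.ofRingEquiv (f := RingEquiv.ofBijective
    ((TwoSidedIdeal.ker φ).ringCon.lift φ.toRingHom fun _ _ h ↦ h) ⟨by
      rintro ⟨a⟩ ⟨b⟩ h
      exact (RingCon.eq _).2 h,
      fun b ↦ (hφ b).imp' (fun a : A ↦ (a : (TwoSidedIdeal.ker φ).ringCon.Quotient))
        fun _ h ↦ h⟩)
    fun c ↦ φ.commutes c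

/-- A ring map from a simple ring to a nonzero ring is injective; apply this to `A/I → A/J`. -/
lemma TwoSidedIdeal.eq_of_le_of_isSimpleRing {A : Type*} [Ring A] {I J : TwoSidedIdeal A}
    [IsSimpleRing I.ringCon.Quotient] [Nontrivial J.ringCon.Quotient] (h : I ≤ J) : I = J := by
  let f : I.ringCon.Quotient →+* J.ringCon.Quotient :=
    RingCon.map _ _ (TwoSidedIdeal.ringCon_le_iff.1 h)
  refine le_antisymm h fun a ha ↦ ?_
  have h0 : f (a : I.ringCon.Quotient) = f (0 : A) := (RingCon.eq _).2 ha
  exact (RingCon.eq _).1 (f.injective h0)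

/-! ### Points, Galois conjugacy and the Nullstellensatz -/

namespace CubicPoint

variable {F : Type*} [Field F] {D : F}

lemma adjoin_eq_top (P : CubicPoint D) : Algebra.adjoin F {P.r₀, P.s₀} = ⊤ := by
  have h : P.field.toSubalgebra = Algebra.adjoin F {P.r, P.s} :=
    IntermediateField.adjoin_toSubalgebra_of_isAlgebraic fun x _ ↦
      Algebra.IsAlgebraic.isAlgebraic x
  have hmap : (Algebra.adjoin F {P.r₀, P.s₀}).map P.field.val = Algebra.adjoin F {P.r, P.s} := by
    rw [AlgHom.map_adjoin, Set.image_pair]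
    rfl
  rw [eq_top_iff]
  rintro k -
  have hk : (k : AlgebraicClosure F) ∈ Algebra.adjoin F {P.r, P.s} := h ▸ k.2
  rw [← hmap] at hk
  obtain ⟨k', hk', hkk'⟩ := hk
  exact (Subtype.ext hkk' : k' = k) ▸ hk'

lemma curve (P : CubicPoint D) : P.s₀ ^ 2 = P.r₀ ^ 3 + algebraMap F P.field D :=
  Subtype.ext P.eq

/-- Evaluation of regular functions at a point. -/
noncomputable def eval (P : CubicPoint D) : (cubicCurve D).CoordinateRing →ₐ[F] P.field :=
  (CubicCoordinateRing.exists_lift P.curve).choose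

lemma eval_r (P : CubicPoint D) : P.eval (CubicCoordinateRing.r D) = P.r₀ :=
  (CubicCoordinateRing.exists_lift P.curve).choose_spec.1

lemma eval_s (P : CubicPoint D) : P.eval (CubicCoordinateRing.s D) = P.s₀ :=
  (CubicCoordinateRing.exists_lift P.curve).choose_spec.2

lemma eval_surjective (P : CubicPoint D) : Function.Surjective P.eval := by
  rw [← AlgHom.range_eq_top, eq_top_iff, ← P.adjoin_eq_top, Algebra.adjoin_le_iff]
  rintro _ (rfl | rfl)
  exacts [⟨_, P.eval_r⟩, ⟨_, P.eval_s⟩]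

lemma algHom_eq_eval (P : CubicPoint D)
    {f : (cubicCurve D).CoordinateRing →ₐ[F] AlgebraicClosure F}
    (hr : f (CubicCoordinateRing.r D) = P.r) (hs : f (CubicCoordinateRing.s D) = P.s) :
    f = P.field.val.comp P.eval :=
  CubicCoordinateRing.algHom_ext (by simp [hr, eval_r, r₀]) (by simp [hs, eval_s, s₀])

lemma eval_smul_eq_zero_iff (σ : AlgebraicClosure F ≃ₐ[F] AlgebraicClosure F) (P : CubicPoint D)
    (g : (cubicCurve D).CoordinateRing) : (σ • P).eval g = 0 ↔ P.eval g = 0 := by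
  have h := (σ • P).algHom_eq_eval (f := σ.toAlgHom.comp (P.field.val.comp P.eval))
    (by simp [eval_r, r₀]; rfl) (by simp [eval_s, s₀]; rfl)
  have h' : σ (P.eval g) = ((σ • P).eval g : AlgebraicClosure F) := DFunLike.congr_fun h g
  rw [← ZeroMemClass.coe_eq_zero, ← h', map_eq_zero, ZeroMemClass.coe_eq_zero]

/-- Points at which the same functions vanish are conjugate. -/
lemma exists_smul_eq {P Q : CubicPoint D} (h : ∀ g, P.eval g = 0 → Q.eval g = 0) :
    ∃ σ : AlgebraicClosure F ≃ₐ[F] AlgebraicClosure F, σ • P = Q := by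
  -- The residue field at `P` is the coordinate ring modulo `ker P.eval`, so evaluation at `Q`
  -- factors through it. The resulting embedding extends to an automorphism of the algebraic
  -- closure.
  let τ : P.field →ₐ[F] AlgebraicClosure F :=
    (Ideal.Quotient.liftₐ (RingHom.ker P.eval) (Q.field.val.comp Q.eval)
      fun g hg ↦ by simpa using h g hg).comp
        (Ideal.quotientKerAlgEquivOfSurjective P.eval_surjective).symm.toAlgHom
  have hτ : ∀ g, τ (P.eval g) = Q.eval g := by
    intro g
    have : (Ideal.quotientKerAlgEquivOfSurjective P.eval_surjective).symm (P.eval g) =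
        Ideal.Quotient.mk _ g := by
      rw [AlgEquiv.symm_apply_eq]
      rfl
    simp only [τ, AlgHom.comp_apply]
    erw [this]
    rfl
  obtain ⟨φ, hφ⟩ := IsAlgClosed.surjective_domRestrict_of_isAlgebraic (K := F) (L := P.field)
    (M := AlgebraicClosure F) (E := AlgebraicClosure F) τ
  have hφ' : ∀ k : P.field, φ k = τ k := fun k ↦ DFunLike.congr_fun hφ k
  refine ⟨AlgEquiv.ofBijective φ (Algebra.IsAlgebraic.algHom_bijective φ), ?_⟩
  ext
  · change φ P.r = Q.r
    have := hτ (CubicCoordinateRing.r D)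
    rwa [← hφ', eval_r, eval_r] at this
  · change φ P.s = Q.s
    have := hτ (CubicCoordinateRing.s D)
    rwa [← hφ', eval_s, eval_s] at this

/-- The Nullstellensatz for `E_D`. -/
lemma exists_eval_eq_zero {I : Ideal (cubicCurve D).CoordinateRing} (hI : I ≠ ⊤) :
    ∃ P : CubicPoint D, ∀ g ∈ I, P.eval g = 0 := by
  obtain ⟨M, hM, hIM⟩ := I.exists_le_maximal hI
  let _ := Ideal.Quotient.field M
  have : Algebra.FiniteType F (cubicCurve D).CoordinateRing :=
    ⟨⟨Set.Finite.toFinset (s := {CubicCoordinateRing.r D, CubicCoordinateRing.s D})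
      (Set.toFinite _), by simpa using CubicCoordinateRing.adjoin_eq_top D⟩⟩
  have : Algebra.FiniteType F ((cubicCurve D).CoordinateRing ⧸ M) :=
    .of_surjective (Ideal.Quotient.mkₐ F M) Ideal.Quotient.mk_surjective
  -- Zariski's lemma: the residue field is finite over `F`, hence embeds in the algebraic closure.
  have : Module.Finite F ((cubicCurve D).CoordinateRing ⧸ M) :=
    finite_of_finite_type_of_isJacobsonRing _ _
  let θ : (cubicCurve D).CoordinateRing →ₐ[F] AlgebraicClosure F :=
    (IsAlgClosed.lift (R := F) (S := (cubicCurve D).CoordinateRing ⧸ M)).comp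
      (Ideal.Quotient.mkₐ F M)
  let P : CubicPoint D := ⟨θ (CubicCoordinateRing.r D), θ (CubicCoordinateRing.s D), by
    rw [← map_pow, CubicCoordinateRing.s_sq, map_add, map_pow, AlgHom.commutes]⟩
  refine ⟨P, fun g hg ↦ ?_⟩
  have hθ : θ g = P.eval g := DFunLike.congr_fun (P.algHom_eq_eval (f := θ) rfl rfl) g
  rw [← ZeroMemClass.coe_eq_zero, ← hθ]
  simp [θ, Ideal.Quotient.eq_zero_iff_mem.2 (hIM hg)]

end CubicPoint

/-! ### Simple images and Galois orbits -/

namespace CPhi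

variable {F : Type*} [Field F] [CharP F 3] {α β γ δ : F}

/-- The homomorphism of `C_Φ` onto the cyclic algebra attached to a point. -/
noncomputable def pointHom (hα : α ≠ 0) (hβ : β ≠ 0) (P : CubicPoint (Δ α β γ δ)) :
    CPhi α β γ δ →ₐ[F] pointAlg α β P :=
  (exists_toSymbol γ δ hα hβ P.curve).choose

variable (hα : α ≠ 0) (hβ : β ≠ 0) (P : CubicPoint (Δ α β γ δ))

lemma pointHom_w : pointHom hα hβ P (w α β γ δ) = algebraMap P.field _ P.r₀ :=
  (exists_toSymbol γ δ hα hβ P.curve).choose_spec.1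

lemma pointHom_y₁ : pointHom hα hβ P (y₁ α β γ δ ^ 3 - algebraMap F _ (β ^ 3)) =
    algebraMap P.field _ P.s₀ :=
  (exists_toSymbol γ δ hα hβ P.curve).choose_spec.2.1

lemma pointHom_surjective : Function.Surjective (pointHom hα hβ P) :=
  (exists_toSymbol γ δ hα hβ P.curve).choose_spec.2.2 P.adjoin_eq_top

include hα in
lemma isSimpleRing_pointAlg : IsSimpleRing (pointAlg α β P) :=
  have : CharP P.field 3 := charP_of_injective_algebraMap (algebraMap F P.field).injective 3
  SymbolAlg.isSimpleRing _ (by simpa using hα)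

instance : Nontrivial (pointAlg α β P) :=
  have : CharP P.field 3 := charP_of_injective_algebraMap (algebraMap F P.field).injective 3
  inferInstance

instance isSimpleRing_quotient_ker_pointHom :
    IsSimpleRing (TwoSidedIdeal.ker (pointHom hα hβ P)).ringCon.Quotient :=
  have := isSimpleRing_pointAlg hα P
  ⟨((TwoSidedIdeal.quotientKerAlgEquiv _
    (pointHom_surjective hα hβ P)).toRingEquiv.mapTwoSidedIdeal).isSimpleOrder⟩

/-- The simple image of `C_Φ` attached to a point. -/
noncomputable def pointImage : SimpleImage (CPhi α β γ δ) :=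
  ⟨TwoSidedIdeal.ker (pointHom hα hβ P), inferInstance⟩

/-- On the center, `pointHom` is evaluation at `P`, because both agree on `r` and `s`. -/
lemma pointHom_center {ι : (cubicCurve (Δ α β γ δ)).CoordinateRing →ₐ[F] CPhi α β γ δ}
    (hr : ι (CubicCoordinateRing.r _) = w α β γ δ)
    (hs : ι (CubicCoordinateRing.s _) = y₁ α β γ δ ^ 3 - algebraMap F (CPhi α β γ δ) (β ^ 3))
    (g : (cubicCurve (Δ α β γ δ)).CoordinateRing) :
    ι g ∈ TwoSidedIdeal.ker (pointHom hα hβ P) ↔ P.eval g = 0 := by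
  have h : (pointHom hα hβ P).comp ι =
      (IsScalarTower.toAlgHom F P.field (pointAlg α β P)).comp P.eval :=
    CubicCoordinateRing.algHom_ext
      (by rw [AlgHom.comp_apply, hr, pointHom_w, AlgHom.comp_apply, P.eval_r]; rfl)
      (by rw [AlgHom.comp_apply, hs, pointHom_y₁, AlgHom.comp_apply, P.eval_s]; rfl)
  have hg : pointHom hα hβ P (ι g) = algebraMap P.field (pointAlg α β P) (P.eval g) :=
    DFunLike.congr_fun h g
  rw [TwoSidedIdeal.mem_ker, hg, map_eq_zero_iff _ (algebraMap P.field _).injective]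

/-- The kernel attached to `P` is determined by the functions vanishing at `P`, that is, by the
orbit of `P`. For surjectivity, the central functions lying in `I` form a proper ideal and vanish at
some point. Thus `I` lies in that point's kernel, and simplicity of the quotient by `I` gives
equality. -/
lemma exists_orbitEquiv : ∃ Ψ : CubicOrbit (Δ α β γ δ) ≃ SimpleImage (CPhi α β γ δ),
    ∀ P, Ψ (Quotient.mk _ P) = pointImage hα hβ P := by
  obtain ⟨e, her, hes, hle⟩ := exists_centerEquiv γ δ hα hβ
  let ι := (Subalgebra.center F (CPhi α β γ δ)).val.comp e.toAlgHom
  have hι : ∀ P g, (e g : CPhi α β γ δ) ∈ TwoSidedIdeal.ker (pointHom hα hβ P) ↔ P.eval g = 0 :=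
    fun P g ↦ pointHom_center hα hβ P (ι := ι) her hes g
  let f : CubicOrbit (Δ α β γ δ) → SimpleImage (CPhi α β γ δ) :=
    Quotient.lift (pointImage hα hβ) (by
      rintro _ P ⟨σ, rfl⟩
      apply Subtype.ext
      apply le_antisymm <;> refine hle _ _ fun g ↦ ?_
      · exact fun h ↦ (hι P g).2 ((P.eval_smul_eq_zero_iff σ g).1 ((hι _ g).1 h))
      · exact fun h ↦ (hι _ g).2 ((P.eval_smul_eq_zero_iff σ g).2 ((hι P g).1 h)))
  refine ⟨Equiv.ofBijective f ⟨?_, ?_⟩, fun P ↦ rfl⟩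
  · rintro ⟨P⟩ ⟨Q⟩ h
    have h' : TwoSidedIdeal.ker (pointHom hα hβ Q) = TwoSidedIdeal.ker (pointHom hα hβ P) :=
      congrArg Subtype.val h.symm
    refine Quotient.sound (CubicPoint.exists_smul_eq fun g hg ↦ ?_)
    rw [← hι] at hg ⊢
    exact h' ▸ hg
  · rintro ⟨I, hI⟩
    let q := I.ringCon.mk'.comp ι.toRingHom
    have hq : ∀ g, g ∈ RingHom.ker q ↔ (e g : CPhi α β γ δ) ∈ I := fun g ↦ RingCon.eq _
    obtain ⟨P, hP⟩ := CubicPoint.exists_eval_eq_zero (RingHom.ker_ne_top q)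
    refine ⟨Quotient.mk _ P, Subtype.ext ?_⟩
    refine (TwoSidedIdeal.eq_of_le_of_isSimpleRing
      (J := TwoSidedIdeal.ker (pointHom hα hβ P)) ?_).symm
    exact hle _ _ fun g hg ↦ (hι P g).2 (hP g ((hq g).2 hg))

end CPhi

theorem mainTheorem6 {F : Type*} [Field F] [CharP F 3] (α β γ δ : F) (hα : α ≠ 0) (hβ : β ≠ 0) :
    -- (1) `C_Φ` is Azumaya (over its center) of constant rank 9
    (IsAzumaya (Subring.center (CPhi α β γ δ)) (CPhi α β γ δ) ∧
      ∀ p : PrimeSpectrum (Subring.center (CPhi α β γ δ)),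
        Module.rankAtStalk (CPhi α β γ δ) p = 9) ∧
    -- (2) the center is `F[w, y₁ ^ 3]`, isomorphic to the coordinate ring of `E_Δ`
    (Subalgebra.center F (CPhi α β γ δ) =
        Algebra.adjoin F {CPhi.w α β γ δ, CPhi.y₁ α β γ δ ^ 3} ∧
      ∃ e : (cubicCurve (CPhi.Δ α β γ δ)).CoordinateRing ≃ₐ[F]
          Subalgebra.center F (CPhi α β γ δ),
        (e (WeierstrassCurve.Affine.CoordinateRing.mk _ (Polynomial.C Polynomial.X)) :
          CPhi α β γ δ) = CPhi.w α β γ δ ∧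
        (e (WeierstrassCurve.Affine.CoordinateRing.mk _ Polynomial.X) :
          CPhi α β γ δ) = CPhi.y₁ α β γ δ ^ 3 - algebraMap F (CPhi α β γ δ) (β ^ 3)) ∧
    -- (3) Galois orbits of points of `E_Δ` correspond to simple images of `C_Φ`
    ∃ Ψ : CubicOrbit (CPhi.Δ α β γ δ) ≃ SimpleImage (CPhi α β γ δ),
      ∀ P : CubicPoint (CPhi.Δ α β γ δ),
        Algebra.IsCentral P.field (pointAlg α β P) ∧
        IsSimpleRing (pointAlg α β P) ∧
        Module.finrank P.field (pointAlg α β P) = 9 ∧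
        ∃ e : (Ψ (Quotient.mk _ P)).1.ringCon.Quotient ≃ₐ[F] pointAlg α β P,
          e (CPhi.w α β γ δ : (Ψ (Quotient.mk _ P)).1.ringCon.Quotient) =
            algebraMap P.field (pointAlg α β P) P.r₀ ∧
          e ((CPhi.y₁ α β γ δ ^ 3 - algebraMap F (CPhi α β γ δ) (β ^ 3) : CPhi α β γ δ) :
              (Ψ (Quotient.mk _ P)).1.ringCon.Quotient) =
            algebraMap P.field (pointAlg α β P) P.s₀ := by
  refine ⟨CPhi.isAzumaya γ δ hα hβ, ⟨CPhi.center_eq_adjoin γ δ hα hβ, ?_⟩, ?_⟩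
  · obtain ⟨e, her, hes, -⟩ := CPhi.exists_centerEquiv γ δ hα hβ
    exact ⟨e, her, hes⟩
  · obtain ⟨Ψ, hΨ⟩ := CPhi.exists_orbitEquiv (γ := γ) (δ := δ) hα hβ
    refine ⟨Ψ, fun P ↦ ?_⟩
    have : CharP P.field 3 := charP_of_injective_algebraMap (algebraMap F P.field).injective 3
    have hα' : algebraMap F P.field α ≠ 0 := by simpa using hα
    refine ⟨SymbolAlg.isCentral _ hα', SymbolAlg.isSimpleRing _ hα',
      SymbolAlg.finrank_eq_nine _ hα', ?_⟩
    rw [hΨ]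
    exact ⟨TwoSidedIdeal.quotientKerAlgEquiv _ (CPhi.pointHom_surjective hα hβ P),
      CPhi.pointHom_w hα hβ P, CPhi.pointHom_y₁ hα hβ P⟩
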